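/- Let $p$ be a prime and $n,s,m$ positive integers with $\gcd(n,p)=1$. Let $\mathbb{F}=\mathbb{F}_{p^m}$, $\mathcal{R}=\mathbb{F}[u]/\langle u^3\rangle$, let $\alpha,\gamma\in\mathbb{F}$ be non-zero, and let $\alpha_0\in\mathbb{F}$ satisfy $\alpha_0^{p^s}=\alpha$. Let $x^n-\alpha_0=f_1(x)\cdots f_r(x)$ with $f_1,\dots,f_r\in\mathbb{F}[x]$ monic and irreducible, and put $d_j=\deg f_j$. There exist $h_1,\dots,h_r\in\mathbb{F}[x]$ such that $$x^{np^s}-(\alpha+\gamma u^2)=\prod_{j=1}^r\big(f_j(x)^{p^s}+u^2h_j(x)\big)\quad\text{in }\mathcal{R}[x].$$ Fix any such $h_1,\dots,h_r$ and any $j$, and let $\mathcal{K}_j=\mathcal{R}[x]/\langle f_j(x)^{p^s}+u^2h_j(x)\rangle$. Then $\langle f_j^{p^s}\rangle=\langle u^2\rangle$ in $\mathcal{K}_j$. Every element of $\mathcal{K}_j$ is written uniquely as $a_0+ua_1+u^2a_2$ with $a_i\in\mathbb{F}[x]$ zero or of degree $<d_jp^s$, and such polynomials are identified with the elements of $\mathbb{F}[x]/\langle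 f_j^{p^s}\rangle$. For an ideal $\mathcal{I}$ of $\mathcal{K}_j$ let $\mathrm{Res}_u(\mathcal{I})$ be the set of $a_0$ such that $a_0+ua_1+u^2a_2\in\mathcal{I}$ for some $a_1,a_2$, let $\mathrm{Tor}_u(\mathcal{I})$ be the set of $a_1$ such that $ua_1+u^2a_2\in\mathcal{I}$ for some $a_2$, and let $\mathrm{Tor}_{u^2}(\mathcal{I})$ be the set of $a_2$ such that $u^2a_2\in\mathcal{I}$. For an integer $N$, say that $G\in\mathbb{F}[x]$ is *admissible of length* $N$ if $G$ is either $0$ or a unit in $\mathcal{K}_j$ of the form $\sum_{i=0}^{N-1}B_i(x)f_j(x)^i$, where each $B_i\in\mathbb{F}[x]$ is zero or of degree $<d_j$ (the sum is $0$ if $N\le 0$). In all formulas below a term containing a factor $G,D_1,D_2$ or $V$ that is $0$ is read as $0$; $t,t_1,t_2,\theta$ are non-negative integers. Let $\mathcal{I}$ be an ideal of $\mathcal{K}_j$ with $\mathcal{I}\ne\{0\}$ and $\mathcal{I}\neq\mathcal{K}_j$. Then there are integers $0\le c\le b\le a\le p^s$ with $\mathrm{Res}_u(\mathcal{I})=\langle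 f_j^a\rangle$, $\mathrm{Tor}_u(\mathcal{I})=\langle f_j^b\rangle$ and $\mathrm{Tor}_{u^2}(\mathcal{I})=\langle f_j^c\rangle$ in $\mathbb{F}[x]/\langle f_j^{p^s}\rangle$, and for any such $a,b,c$ the following hold. **Type I.** If $a=b=p^s$, then $c<p^s$, $\mathcal{I}=\langle u^2f_j^c\rangle$, $|\mathcal{I}|=p^{md_j(p^s-c)}$ and $\mathrm{ann}(\mathcal{I})=\langle f_j^{p^s-c},u\rangle$. **Type II.** If $a=p^s$ and $b<p^s$, then $$\mathcal{I}=\langle uf_j^b+u^2f_j^tG,\ u^2f_j^c\rangle$$ for some $t$ and some $G$ admissible of length $c-t$, where $c+b-p^s\le t<c$ if $G\ne0$. Moreover $|\mathcal{I}|=p^{md_j(2p^s-b-c)}$, and for every such presentation of $\mathcal{I}$, $$\mathrm{ann}(\mathcal{I})=\langle f_j^{p^s-c}-uf_j^{p^s-c+t-b}G,\ uf_j^{p^s-b},\ u^2\rangle.$$ **Type III.** If $a<p^s$, then $$\mathcal{I}=\langle f_j^a+uf_j^{t_1}D_1+u^2f_j^{t_2}D_2,\ uf_j^b+u^2f_j^\theta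 V,\ u^2f_j^c\rangle$$ for some $t_1,t_2,\theta$ and some $D_1,D_2,V$ admissible of lengths $b-t_1$, $c-t_2$, $c-\theta$ respectively, where $a+b-p^s\le t_1<b$ if $D_1\ne0$, $0\le t_2<c$ if $D_2\ne0$, and $b+c-p^s\le\theta<c$ if $V\neq0$. Moreover $|\mathcal{I}|=p^{md_j(3p^s-a-b-c)}$, and for every such presentation of $\mathcal{I}$, $$u^2\big(h_j+f_j^{p^s-a+t_1-b+\theta}VD_1-f_j^{p^s-a+t_2}D_2\big)\in\langle u^2f_j^c\rangle,$$ that is, this element equals $u^2f_j^cB$ for some $B\in\mathbb{F}[x]/\langle f_j^{p^s}\rangle$; and for every such $B$, $$\mathrm{ann}(\mathcal{I})=\langle f_j^{p^s-c}-uf_j^{p^s-c+\theta-b}V+u^2B,\ uf_j^{p^s-b}-u^2f_j^{p^s-a+t_1-b}D_1,\ u^2f_j^{p^s-a}\rangle.$$ -/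

import Mathlib

open Polynomial

namespace ConstacyclicU3

/-- The finite chain ring `𝓡 = F[u] / ⟨u³⟩`. -/
abbrev ChainRing (F : Type*) [Field F] : Type _ :=
  AdjoinRoot ((X : F[X]) ^ 3)

/-- The class of the indeterminate, i.e. the element `u` of `𝓡` (so that `u³ = 0`). -/
noncomputable def uR (F : Type*) [Field F] : ChainRing F :=
  AdjoinRoot.root ((X : F[X]) ^ 3)

/-- The inclusion `F[x] → 𝓡[x]`. -/
noncomputable def incl (F : Type*) [Field F] : F[X] →+* (ChainRing F)[X] :=
  Polynomial.mapRingHom (algebraMap F (ChainRing F))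

/-- The polynomial `k(x) = f(x)^q + u² h(x)` of `𝓡[x]`. -/
noncomputable def kPoly {F : Type*} [Field F] (f h : F[X]) (q : ℕ) : (ChainRing F)[X] :=
  incl F f ^ q + C (uR F ^ 2) * incl F h

/-- The ring `𝓚 = 𝓡[x] / ⟨f(x)^q + u² h(x)⟩`. -/
abbrev KRing {F : Type*} [Field F] (f h : F[X]) (q : ℕ) : Type _ :=
  AdjoinRoot (kPoly f h q)

/-- The element of `𝓚` represented by a polynomial with coefficients in `F`. -/
noncomputable def toK {F : Type*} [Field F] (f h : F[X]) (q : ℕ) : F[X] →+* KRing f h q :=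
  (AdjoinRoot.mk (kPoly f h q)).comp (incl F)

/-- The element `u` of `𝓚`. -/
noncomputable def uK {F : Type*} [Field F] (f h : F[X]) (q : ℕ) : KRing f h q :=
  AdjoinRoot.of (kPoly f h q) (uR F)

/-- `F[x] / ⟨f(x)^q⟩`. -/
abbrev ResRing {F : Type*} [Field F] (f : F[X]) (q : ℕ) : Type _ :=
  AdjoinRoot (f ^ q)

/-- The class of a polynomial in `F[x] / ⟨f(x)^q⟩`. -/
noncomputable def toRes {F : Type*} [Field F] (f : F[X]) (q : ℕ) : F[X] →+* ResRing f q :=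
  AdjoinRoot.mk (f ^ q)

/-- `Res_u(I)`: the classes `a₀` for which `a₀ + u a₁ + u² a₂ ∈ I` for some `a₁, a₂`; classes are
represented by polynomials of degree less than `q · deg f`. -/
def resU {F : Type*} [Field F] {f h : F[X]} {q : ℕ} (I : Ideal (KRing f h q)) :
    Set (ResRing f q) :=
  {z | ∃ a₀ ∈ degreeLT F (f.natDegree * q), ∃ a₁ ∈ degreeLT F (f.natDegree * q),
    ∃ a₂ ∈ degreeLT F (f.natDegree * q), z = toRes f q a₀ ∧
      toK f h q a₀ + uK f h q * toK f h q a₁ + uK f h q ^ 2 * toK f h q a₂ ∈ I}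

/-- `Tor_u(I)`: the classes `a₁` for which `u a₁ + u² a₂ ∈ I` for some `a₂`. -/
def torU {F : Type*} [Field F] {f h : F[X]} {q : ℕ} (I : Ideal (KRing f h q)) :
    Set (ResRing f q) :=
  {z | ∃ a₁ ∈ degreeLT F (f.natDegree * q), ∃ a₂ ∈ degreeLT F (f.natDegree * q),
    z = toRes f q a₁ ∧ uK f h q * toK f h q a₁ + uK f h q ^ 2 * toK f h q a₂ ∈ I}

/-- `Tor_{u²}(I)`: the classes `a₂` for which `u² a₂ ∈ I`. -/
def torU2 {F : Type*} [Field F] {f h : F[X]} {q : ℕ} (I : Ideal (KRing f h q)) :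
    Set (ResRing f q) :=
  {z | ∃ a₂ ∈ degreeLT F (f.natDegree * q),
    z = toRes f q a₂ ∧ uK f h q ^ 2 * toK f h q a₂ ∈ I}

/-- `0 ≤ c ≤ b ≤ a ≤ q` and `Res_u(I) = ⟨f^a⟩`, `Tor_u(I) = ⟨f^b⟩`, `Tor_{u²}(I) = ⟨f^c⟩`
in `F[x] / ⟨f^q⟩`. -/
structure HasExponents {F : Type*} [Field F] {f h : F[X]} {q : ℕ} (I : Ideal (KRing f h q))
    (a b c : ℕ) : Prop where
  c_le_b : c ≤ b
  b_le_a : b ≤ a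
  a_le_q : a ≤ q
  res_eq : resU I = ↑(Ideal.span {toRes f q f ^ a} : Ideal (ResRing f q))
  tor_eq : torU I = ↑(Ideal.span {toRes f q f ^ b} : Ideal (ResRing f q))
  tor2_eq : torU2 I = ↑(Ideal.span {toRes f q f ^ c} : Ideal (ResRing f q))

/-- `G(x)` is either `0` or a unit of `𝓚`, and has the form `∑_{i=0}^{N-1} B_i(x) f(x)^i` with
every `B_i(x)` zero or of degree less than `deg f`. -/
def IsZeroOrUnitForm {F : Type*} [Field F] (f h : F[X]) (q N : ℕ) (G : F[X]) : Prop :=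
  (G = 0 ∨ IsUnit (toK f h q G)) ∧
    ∃ B : ℕ → F[X], (∀ i, B i ∈ degreeLT F f.natDegree) ∧
      G = ∑ i ∈ Finset.range N, B i * f ^ i

/-- The data `t, G(x)` present `I` as an ideal of Type II:
`I = ⟨u f^b + u² f^t G, u² f^c⟩`. -/
structure IsTypeII {F : Type*} [Field F] {f h : F[X]} {q : ℕ} (I : Ideal (KRing f h q))
    (b c t : ℕ) (G : F[X]) : Prop where
  /-- `c + b - q ≤ t < c` if `G ≠ 0`. -/
  bound : G ≠ 0 → c + b ≤ t + q ∧ t < c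
  form : IsZeroOrUnitForm f h q (c - t) G
  eq_span : I = Ideal.span
    {uK f h q * toK f h q f ^ b + uK f h q ^ 2 * toK f h q f ^ t * toK f h q G,
      uK f h q ^ 2 * toK f h q f ^ c}

/-- The data `t₁, t₂, θ, D₁(x), D₂(x), V(x)` present `I` as an ideal of Type III:
`I = ⟨f^a + u f^t₁ D₁ + u² f^t₂ D₂, u f^b + u² f^θ V, u² f^c⟩`. -/
structure IsTypeIII {F : Type*} [Field F] {f h : F[X]} {q : ℕ} (I : Ideal (KRing f h q))
    (a b c t₁ t₂ θ : ℕ) (D₁ D₂ V : F[X]) : Prop where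
  /-- `a + b - q ≤ t₁ < b` if `D₁ ≠ 0`. -/
  bound₁ : D₁ ≠ 0 → a + b ≤ t₁ + q ∧ t₁ < b
  /-- `0 ≤ t₂ < c` if `D₂ ≠ 0`. -/
  bound₂ : D₂ ≠ 0 → t₂ < c
  /-- `b + c - q ≤ θ < c` if `V ≠ 0`. -/
  bound₃ : V ≠ 0 → b + c ≤ θ + q ∧ θ < c
  form₁ : IsZeroOrUnitForm f h q (b - t₁) D₁
  form₂ : IsZeroOrUnitForm f h q (c - t₂) D₂
  form₃ : IsZeroOrUnitForm f h q (c - θ) V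
  eq_span : I = Ideal.span
    {toK f h q f ^ a + uK f h q * toK f h q f ^ t₁ * toK f h q D₁
        + uK f h q ^ 2 * toK f h q f ^ t₂ * toK f h q D₂,
      uK f h q * toK f h q f ^ b + uK f h q ^ 2 * toK f h q f ^ θ * toK f h q V,
      uK f h q ^ 2 * toK f h q f ^ c}

/-- The element `u² (h + f^(q-a+t₁-b+θ) V D₁ - f^(q-a+t₂) D₂)` of `𝓚`. The truncated
subtraction is the true one whenever `a ≤ q` and either `D₁ = 0` or `a + b ≤ t₁ + q`. -/
noncomputable def defect {F : Type*} [Field F] (f h : F[X]) (q a b t₁ t₂ θ : ℕ)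
    (D₁ D₂ V : F[X]) : KRing f h q :=
  uK f h q ^ 2 * (toK f h q h
    + toK f h q f ^ (q - a + t₁ - b + θ) * toK f h q V * toK f h q D₁
    - toK f h q f ^ (q - a + t₂) * toK f h q D₂)

end ConstacyclicU3

namespace ConstacyclicU3

/-! Write `q = p^s`. All ideal theory in `K` is reduced to divisibility in `F[x]`. Every element has
the form `a₀ + u a₁ + u² a₂` with `aᵢ` in `F[x]`, and `IsPresentation` says exactly when such an
expression vanishes. The only link between levels is `f^q = -u² h`; moreover `u f^q = 0`, so on
`⟨u⟩` vanishing is coefficientwise divisibility by `f^q`.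

The residue and torsion sets of `I`, lifted to `F[x]`, are ideals containing `f^q`, so they are
generated by powers `f^a`, `f^b`, `f^c`; multiplication by `u` nests them. Lifting these powers to
`g₀ = f^a + u d₁ + u² d₂`, `g₁ = u f^b + u² v` and `g₂ = u² f^c` in `I`, division level by level
shows that every element of `I` is a unique combination of them with coefficients of bounded degree
(`exists_combination`, `eq_zero_of_combination_eq_zero`). This gives both the generators and the
cardinality.

Combinations of `g₀`, `g₁` that fall to a lower level yield divisibility constraints on `d₁`, `d₂`,
`v`: these are the bounds on `t₁`, `θ` and the existence of `B`. For the annihilator, the equations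
`x g₂ = 0`, `x g₁ = 0`, `x g₀ = 0` are solved successively for the three coefficients of `x`.

The `h_j` exist by a Bézout identity for the coprime powers `f_j^q`; the same identity shows that
`f_j` does not divide `h_j`, so `h_j` is a unit and `⟨f_j^q⟩ = ⟨u²⟩`. -/

/-- The ring `K`, generated over `F[x]` by an element `u` with `u³ = 0`, has the defining relation
`f^q + u² h = 0`. -/
structure IsPresentation {F : Type*} [Field F] (f h : F[X]) (q : ℕ) {K : Type*} [CommRing K]
    (ι : F[X] →+* K) (u : K) : Prop where
  u_cube : u ^ 3 = 0
  exists_rep : ∀ x : K, ∃ a₀ a₁ a₂ : F[X], x = ι a₀ + u * ι a₁ + u ^ 2 * ι a₂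
  eq_zero_iff : ∀ a₀ a₁ a₂ : F[X], ι a₀ + u * ι a₁ + u ^ 2 * ι a₂ = 0 ↔
    ∃ g, a₀ = f ^ q * g ∧ f ^ q ∣ a₁ ∧ f ^ q ∣ a₂ - h * g

/-! ### Coordinates over `F[x]` and the defining relation -/

section ChainRing

variable {F : Type*} [Field F]

lemma uR_cube : uR F ^ 3 = 0 := by
  have h : AdjoinRoot.mk ((X : F[X]) ^ 3) (X ^ 3) = 0 := AdjoinRoot.mk_self
  rwa [map_pow, AdjoinRoot.mk_X] at h

lemma chainRing_exists_rep (x : ChainRing F) : ∃ c₀ c₁ c₂ : F,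
    x = algebraMap F (ChainRing F) c₀ + uR F * algebraMap F (ChainRing F) c₁
      + uR F ^ 2 * algebraMap F (ChainRing F) c₂ := by
  obtain ⟨g, rfl⟩ := AdjoinRoot.mk_surjective x
  refine ⟨g.coeff 0, g.divX.coeff 0, g.divX.divX.coeff 0, ?_⟩
  have h : g = C (g.coeff 0) + X * C (g.divX.coeff 0) + X ^ 2 * C (g.divX.divX.coeff 0)
      + X ^ 3 * g.divX.divX.divX := by
    linear_combination -g.divX_mul_X_add - X * g.divX.divX_mul_X_add
      - X ^ 2 * g.divX.divX.divX_mul_X_add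
  have h3 := uR_cube (F := F)
  conv_lhs => rw [h]
  simp only [map_add, map_mul, map_pow, AdjoinRoot.mk_X, AdjoinRoot.mk_C]
  change _ + uR F * _ + uR F ^ 2 * _ + uR F ^ 3 * _ = _
  rw [h3, zero_mul, add_zero]
  rfl

lemma chainRing_eq_zero {c₀ c₁ c₂ : F}
    (h : algebraMap F (ChainRing F) c₀ + uR F * algebraMap F (ChainRing F) c₁
      + uR F ^ 2 * algebraMap F (ChainRing F) c₂ = 0) : c₀ = 0 ∧ c₁ = 0 ∧ c₂ = 0 := by
  have h' : AdjoinRoot.mk ((X : F[X]) ^ 3) (C c₀ + C c₁ * X + C c₂ * X ^ 2) = 0 := by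
    simp only [map_add, map_mul, map_pow, AdjoinRoot.mk_X, AdjoinRoot.mk_C]
    rw [mul_comm _ (AdjoinRoot.root _), mul_comm _ (AdjoinRoot.root _ ^ 2)]
    exact h
  rw [AdjoinRoot.mk_eq_zero, X_pow_dvd_iff] at h'
  have e0 := h' 0 (by norm_num)
  have e1 := h' 1 (by norm_num)
  have e2 := h' 2 (by norm_num)
  simp [coeff_X, coeff_X_pow, coeff_C] at e0 e1 e2
  exact ⟨e0, e1, e2⟩

lemma incl_exists_rep (P : (ChainRing F)[X]) : ∃ a₀ a₁ a₂ : F[X],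
    P = incl F a₀ + C (uR F) * incl F a₁ + C (uR F) ^ 2 * incl F a₂ := by
  induction P using Polynomial.induction_on' with
  | add P Q hP hQ =>
    obtain ⟨a₀, a₁, a₂, rfl⟩ := hP
    obtain ⟨b₀, b₁, b₂, rfl⟩ := hQ
    exact ⟨a₀ + b₀, a₁ + b₁, a₂ + b₂, by simp only [map_add]; ring⟩
  | monomial n x =>
    obtain ⟨c₀, c₁, c₂, rfl⟩ := chainRing_exists_rep x
    refine ⟨monomial n c₀, monomial n c₁, monomial n c₂, ?_⟩
    simp [incl, ← C_mul_X_pow_eq_monomial]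
    ring

lemma incl_eq_zero {a₀ a₁ a₂ : F[X]}
    (h : incl F a₀ + C (uR F) * incl F a₁ + C (uR F) ^ 2 * incl F a₂ = 0) :
    a₀ = 0 ∧ a₁ = 0 ∧ a₂ = 0 := by
  have key (n : ℕ) : a₀.coeff n = 0 ∧ a₁.coeff n = 0 ∧ a₂.coeff n = 0 := by
    apply chainRing_eq_zero
    have := congrArg (fun P => P.coeff n) h
    simpa only [incl, ← C_pow, coeff_add, coeff_C_mul, coe_mapRingHom, coeff_map, coeff_zero]
      using this
  exact ⟨ext fun n => (key n).1, ext fun n => (key n).2.1, ext fun n => (key n).2.2⟩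

/-- Comparing coefficients in `(f^q + u² h)(b₀ + u b₁ + u² b₂) = f^q b₀ + u f^q b₁ + u² (f^q b₂ + h
b₀)`, where `u³ = 0`, describes the multiples of the modulus; the witness `g` is `b₀`. -/
lemma isPresentation (f h : F[X]) (q : ℕ) :
    IsPresentation f h q (toK f h q) (uK f h q) := by
  have hu : AdjoinRoot.mk (kPoly f h q) (C (uR F)) = uK f h q := AdjoinRoot.mk_C _
  have h3 : (C (uR F) : (ChainRing F)[X]) ^ 3 = 0 := by rw [← C_pow, uR_cube, C_0]
  have hmk (a₀ a₁ a₂ : F[X]) : toK f h q a₀ + uK f h q * toK f h q a₁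
      + uK f h q ^ 2 * toK f h q a₂ = AdjoinRoot.mk (kPoly f h q)
        (incl F a₀ + C (uR F) * incl F a₁ + C (uR F) ^ 2 * incl F a₂) := by
    simp only [map_add, map_mul, map_pow, hu]; rfl
  refine ⟨?_, fun x => ?_, fun a₀ a₁ a₂ => ?_⟩
  · rw [← hu, ← map_pow, h3, map_zero]
  · obtain ⟨P, rfl⟩ := AdjoinRoot.mk_surjective x
    obtain ⟨a₀, a₁, a₂, rfl⟩ := incl_exists_rep P
    exact ⟨a₀, a₁, a₂, (hmk _ _ _).symm⟩
  · rw [hmk, AdjoinRoot.mk_eq_zero]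
    constructor
    · rintro ⟨P, hP⟩
      obtain ⟨b₀, b₁, b₂, rfl⟩ := incl_exists_rep P
      have := incl_eq_zero (a₀ := a₀ - f ^ q * b₀) (a₁ := a₁ - f ^ q * b₁)
        (a₂ := a₂ - f ^ q * b₂ - h * b₀) (by
          simp only [map_sub, map_mul, map_pow]
          simp only [kPoly, C_pow] at hP
          linear_combination hP + (C (uR F) * incl F h * incl F b₂ + incl F h * incl F b₁) * h3)
      exact ⟨b₀, by linear_combination this.1, ⟨b₁, by linear_combination this.2.1⟩,
        ⟨b₂, by linear_combination this.2.2⟩⟩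
    · rintro ⟨g, rfl, ⟨k₁, rfl⟩, k₂, hk₂⟩
      refine ⟨incl F g + C (uR F) * incl F k₁ + C (uR F) ^ 2 * incl F k₂, ?_⟩
      have := congrArg (incl F) hk₂
      simp only [map_sub, map_mul, map_pow] at this
      simp only [kPoly, map_mul, map_pow]
      linear_combination C (uR F) ^ 2 * this
        - (C (uR F) * incl F h * incl F k₂ + incl F h * incl F k₁) * h3

end ChainRing

/-! ### Division by powers of `f` and base-`f` expansions -/

section Polynomials

variable {F : Type*} [Field F] {f : F[X]}

lemma exists_degreeLT_add_pow_mul (hf : f.Monic) (k : ℕ) (v : F[X]) :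
    ∃ w ∈ degreeLT F (f.natDegree * k), ∃ s, v = w + f ^ k * s := by
  refine ⟨v %ₘ f ^ k, ?_, v /ₘ f ^ k, (modByMonic_add_div v (f ^ k)).symm⟩
  rw [mem_degreeLT]
  have h := degree_modByMonic_lt v (hf.pow k)
  rwa [degree_eq_natDegree (hf.pow k).ne_zero, natDegree_pow, mul_comm] at h

lemma eq_zero_of_pow_dvd_of_mem_degreeLT (hf : f.Monic) {k : ℕ} {v : F[X]}
    (hv : v ∈ degreeLT F (f.natDegree * k)) (h : f ^ k ∣ v) : v = 0 := by
  refine eq_zero_of_dvd_of_degree_lt h ?_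
  rw [degree_eq_natDegree (hf.pow k).ne_zero, natDegree_pow, mul_comm]
  exact mem_degreeLT.1 hv

lemma exists_base_expansion (hf : f.Monic) (N : ℕ) (v : F[X])
    (hv : v ∈ degreeLT F (f.natDegree * N)) :
    ∃ B : ℕ → F[X], (∀ i, B i ∈ degreeLT F f.natDegree) ∧
      v = ∑ i ∈ Finset.range N, B i * f ^ i := by
  induction N generalizing v with
  | zero => exact ⟨0, fun i => zero_mem _, by simpa [mem_degreeLT] using hv⟩
  | succ N ih =>
    obtain ⟨w, hw, s, rfl⟩ := exists_degreeLT_add_pow_mul hf N v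
    obtain ⟨B, hB, rfl⟩ := ih w hw
    have hs : s ∈ degreeLT F f.natDegree := by
      set w := ∑ i ∈ Finset.range N, B i * f ^ i
      have hle : degreeLT F (f.natDegree * N) ≤ degreeLT F (f.natDegree * (N + 1)) :=
        degreeLT_mono (by gcongr; omega)
      have h : f ^ N * s ∈ degreeLT F (f.natDegree * (N + 1)) := by
        simpa using sub_mem hv (hle hw)
      rw [mem_degreeLT] at h ⊢
      by_cases hs : s = 0
      · simp [hs, bot_lt_iff_ne_bot]
      · rw [degree_eq_natDegree (mul_ne_zero (hf.pow N).ne_zero hs),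
          (hf.pow N).natDegree_mul' hs, natDegree_pow, Nat.cast_lt, Nat.mul_succ] at h
        rw [degree_eq_natDegree hs, Nat.cast_lt]
        linarith
    refine ⟨fun i => if i = N then s else B i, fun i => ?_, ?_⟩
    · by_cases hi : i = N <;> simp only [hi, if_true, if_false]
      · exact hs
      · exact hB i
    · rw [Finset.sum_range_succ]
      simp only [if_true]
      rw [mul_comm s]
      congr 1
      exact Finset.sum_congr rfl fun i hi => by
        rw [if_neg (Finset.mem_range.1 hi).ne]

lemma natCard_degreeLT (k : ℕ) : Nat.card (degreeLT F k) = Nat.card F ^ k := by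
  rw [Nat.card_congr (degreeLTEquiv F k).toEquiv, Nat.card_fun, Nat.card_fin]

end Polynomials

/-! ### Torsion exponents and relations in `K` -/

/-- The ideal `I` of `K` has residue and torsion ideals generated by `f^a`, `f^b`, `f^c`; these are
regarded as ideals of `F[x]` containing `f^q`. -/
structure TorsionExponents {F : Type*} [Field F] (f : F[X]) (q : ℕ) {K : Type*} [CommRing K]
    (ι : F[X] →+* K) (u : K) (I : Ideal K) (a b c : ℕ) : Prop where
  c_le_b : c ≤ b
  b_le_a : b ≤ a
  a_le_q : a ≤ q
  res : ∀ a₀, (∃ a₁ a₂, ι a₀ + u * ι a₁ + u ^ 2 * ι a₂ ∈ I) ↔ f ^ a ∣ a₀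
  tor : ∀ a₁, (∃ a₂, u * ι a₁ + u ^ 2 * ι a₂ ∈ I) ↔ f ^ b ∣ a₁
  tor2 : ∀ a₂, u ^ 2 * ι a₂ ∈ I ↔ f ^ c ∣ a₂

namespace IsPresentation

variable {F : Type*} [Field F] {f h : F[X]} {q : ℕ} {K : Type*} [CommRing K]
  {ι : F[X] →+* K} {u : K} {I : Ideal K} {a b c : ℕ}

section Relations

variable (hK : IsPresentation f h q ι u)
include hK

lemma pow_eq : ι f ^ q = -(u ^ 2 * ι h) := by
  have := (hK.eq_zero_iff (f ^ q) 0 h).2 ⟨1, by simp, dvd_zero _, by simp⟩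
  simp only [map_pow, map_zero] at this
  linear_combination this

lemma u_mul_pow : u * ι f ^ q = 0 := by
  linear_combination u * hK.pow_eq - ι h * hK.u_cube

/-- A zero constant coefficient forces `g = 0`, so `h` drops out of the vanishing criterion. -/
lemma eq_zero_iff' (hf : f ≠ 0) (a₁ a₂ : F[X]) :
    u * ι a₁ + u ^ 2 * ι a₂ = 0 ↔ f ^ q ∣ a₁ ∧ f ^ q ∣ a₂ := by
  have := hK.eq_zero_iff 0 a₁ a₂
  rw [map_zero, zero_add] at this
  rw [this]
  constructor
  · rintro ⟨g, hg, h1, h2⟩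
    obtain rfl : g = 0 := by simpa [hf] using hg
    exact ⟨h1, by simpa using h2⟩
  · rintro ⟨h1, h2⟩
    exact ⟨0, by simp, h1, by simpa using h2⟩

lemma u_sq_mul_eq_zero_iff (hf : f ≠ 0) (a₂ : F[X]) : u ^ 2 * ι a₂ = 0 ↔ f ^ q ∣ a₂ := by
  simpa using hK.eq_zero_iff' hf 0 a₂

lemma isNilpotent : ι f ^ (q * 2) = 0 := by
  rw [pow_mul, hK.pow_eq]
  linear_combination u * ι h ^ 2 * hK.u_cube

/-- Since `f^(2q) = u⁴ h² = 0`, a Bézout identity between `G` and `f^(2q)` becomes an inverse of `G`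
in `K`. -/
lemma isUnit_of_not_dvd (hf : Irreducible f) {G : F[X]} (hG : ¬ f ∣ G) : IsUnit (ι G) := by
  obtain ⟨x, y, hxy⟩ := ((hf.coprime_iff_not_dvd.2 hG).pow_left (m := q * 2)).symm
  have := congrArg ι hxy
  rw [map_add, map_mul, map_mul, map_pow, hK.isNilpotent, mul_zero, add_zero, map_one] at this
  exact IsUnit.of_mul_eq_one_right _ this

/-- Coprimality of `h` and `f` makes `f^q` and `u²` associated in `K`. -/
lemma span_pow_eq (hf : Irreducible f) (hh : ¬ f ∣ h) :
    Ideal.span {ι f ^ q} = Ideal.span {u ^ 2} := by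
  rw [hK.pow_eq, Ideal.span_singleton_neg]
  exact Ideal.span_singleton_mul_right_unit (hK.isUnit_of_not_dvd hf hh) _

end Relations

end IsPresentation

lemma exists_mem_iff_pow_dvd {F : Type*} [Field F] {f : F[X]} (hf : Irreducible f) {q : ℕ}
    (J : Ideal F[X]) (hJ : f ^ q ∈ J) : ∃ k ≤ q, ∀ x, x ∈ J ↔ f ^ k ∣ x := by
  obtain ⟨g, rfl⟩ := (IsPrincipalIdealRing.principal J).principal
  rw [← Ideal.span, Ideal.mem_span_singleton] at hJ
  obtain ⟨k, hk, hg⟩ := (dvd_prime_pow hf.prime q).1 hJ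
  refine ⟨k, hk, fun x => ?_⟩
  rw [← Ideal.span, Ideal.mem_span_singleton, hg.dvd_iff_dvd_left]

namespace IsPresentation

variable {F : Type*} [Field F] {f h : F[X]} {q : ℕ} {K : Type*} [CommRing K]
  {ι : F[X] →+* K} {u : K} {I : Ideal K} {a b c : ℕ}

/-- With representatives of arbitrary degree the three sets are ideals of the principal ideal domain
`F[x]`. Multiplying by `u` moves each into the next, so `f^q` in the first lies in all of them. -/
lemma exists_torsionExponents (hK : IsPresentation f h q ι u) (hf : Irreducible f) (I : Ideal K) :
    ∃ a b c, TorsionExponents f q ι u I a b c := by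
  have h3 := hK.u_cube
  let J₀ : Ideal F[X] :=
    { carrier := {a₀ | ∃ a₁ a₂, ι a₀ + u * ι a₁ + u ^ 2 * ι a₂ ∈ I}
      zero_mem' := ⟨0, 0, by simp⟩
      add_mem' := by
        rintro x y ⟨x₁, x₂, hx⟩ ⟨y₁, y₂, hy⟩
        refine ⟨x₁ + y₁, x₂ + y₂, ?_⟩
        convert I.add_mem hx hy using 1
        simp only [map_add]; ring
      smul_mem' := by
        rintro r x ⟨x₁, x₂, hx⟩
        refine ⟨r * x₁, r * x₂, ?_⟩
        convert I.mul_mem_left (ι r) hx using 1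
        simp only [map_mul, smul_eq_mul]; ring }
  let J₁ : Ideal F[X] :=
    { carrier := {a₁ | ∃ a₂, u * ι a₁ + u ^ 2 * ι a₂ ∈ I}
      zero_mem' := ⟨0, by simp⟩
      add_mem' := by
        rintro x y ⟨x₂, hx⟩ ⟨y₂, hy⟩
        refine ⟨x₂ + y₂, ?_⟩
        convert I.add_mem hx hy using 1
        simp only [map_add]; ring
      smul_mem' := by
        rintro r x ⟨x₂, hx⟩
        refine ⟨r * x₂, ?_⟩
        convert I.mul_mem_left (ι r) hx using 1
        simp only [map_mul, smul_eq_mul]; ring }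
  let J₂ : Ideal F[X] :=
    { carrier := {a₂ | u ^ 2 * ι a₂ ∈ I}
      zero_mem' := by simp
      add_mem' := by
        intro x y hx hy
        change u ^ 2 * ι (x + y) ∈ I
        rw [map_add, mul_add]
        exact I.add_mem hx hy
      smul_mem' := by
        intro r x hx
        change u ^ 2 * ι (r * x) ∈ I
        rw [map_mul, mul_left_comm]
        exact I.mul_mem_left (ι r) hx }
  have h01 : J₀ ≤ J₁ := by
    rintro x ⟨x₁, x₂, hx⟩
    refine ⟨x₁, ?_⟩
    convert I.mul_mem_left u hx using 1
    linear_combination -ι x₂ * h3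
  have h12 : J₁ ≤ J₂ := by
    rintro x ⟨x₂, hx⟩
    change u ^ 2 * ι x ∈ I
    convert I.mul_mem_left u hx using 1
    linear_combination -ι x₂ * h3
  -- The relation `f^q + u² h = 0` supplies the witnesses `0` and `h`.
  have h0 : f ^ q ∈ J₀ := ⟨0, h, by simp [hK.pow_eq]⟩
  obtain ⟨a, ha, hJ₀⟩ := exists_mem_iff_pow_dvd hf J₀ h0
  obtain ⟨b, hb, hJ₁⟩ := exists_mem_iff_pow_dvd hf J₁ (h01 h0)
  obtain ⟨c, hc, hJ₂⟩ := exists_mem_iff_pow_dvd hf J₂ (h12 (h01 h0))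
  refine ⟨a, b, c, ?_, ?_, ha, hJ₀, hJ₁, hJ₂⟩
  · exact (pow_dvd_pow_iff hf.ne_zero hf.not_isUnit).1 ((hJ₂ _).1 (h12 ((hJ₁ _).2 dvd_rfl)))
  · exact (pow_dvd_pow_iff hf.ne_zero hf.not_isUnit).1 ((hJ₁ _).1 (h01 ((hJ₀ _).2 dvd_rfl)))

/-! ### Generators, unique combinations and cardinality -/

section Generators

variable (hK : IsPresentation f h q ι u) (hI : TorsionExponents f q ι u I a b c)
include hK hI

/-- Each exponent makes the current lowest coefficient divisible by the leading power of the
matching generator, so a multiple of that generator clears it. Coefficients are truncated as they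
arise, since any excess is a multiple of `f^q`. -/
lemma exists_combination (hm : f.Monic) {d₁ d₂ v : F[X]}
    (hg₀ : ι f ^ a + u * ι d₁ + u ^ 2 * ι d₂ ∈ I) (hg₁ : u * ι f ^ b + u ^ 2 * ι v ∈ I)
    {x : K} (hx : x ∈ I) :
    ∃ s₀ ∈ degreeLT F (f.natDegree * (q - a)), ∃ s₁ ∈ degreeLT F (f.natDegree * (q - b)),
      ∃ s₂ ∈ degreeLT F (f.natDegree * (q - c)),
        x = ι s₀ * (ι f ^ a + u * ι d₁ + u ^ 2 * ι d₂) + ι s₁ * (u * ι f ^ b + u ^ 2 * ι v)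
          + ι s₂ * (u ^ 2 * ι f ^ c) := by
  have hu := hK.u_mul_pow
  have hq := hK.pow_eq
  have ha := hI.a_le_q
  have hb := hI.b_le_a.trans ha
  have hc := hI.c_le_b.trans hb
  obtain ⟨a₀, a₁, a₂, rfl⟩ := hK.exists_rep x
  obtain ⟨s, rfl⟩ := (hI.res a₀).1 ⟨_, _, hx⟩
  obtain ⟨s₀, hs₀, t₀, rfl⟩ := exists_degreeLT_add_pow_mul hm (q - a) s
  have ea : ι f ^ a * ι f ^ (q - a) = ι f ^ q := by rw [← pow_add, Nat.add_sub_cancel' ha]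
  have eb : ι f ^ b * ι f ^ (q - b) = ι f ^ q := by rw [← pow_add, Nat.add_sub_cancel' hb]
  have ec : ι f ^ c * ι f ^ (q - c) = ι f ^ q := by rw [← pow_add, Nat.add_sub_cancel' hc]
  -- The excess `f^q t₀` equals `-u² h t₀`, which accounts for the term `h t₀`; the later excesses
  -- are killed by `u f^q = 0`.
  have h1 : u * ι (a₁ - s₀ * d₁) + u ^ 2 * ι (a₂ - s₀ * d₂ - h * t₀) ∈ I := by
    convert I.sub_mem hx (I.mul_mem_left (ι s₀) hg₀) using 1
    simp only [map_add, map_sub, map_mul, map_pow]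
    linear_combination -ι t₀ * ea - ι t₀ * hq
  obtain ⟨s, hs⟩ := (hI.tor _).1 ⟨_, h1⟩
  obtain ⟨s₁, hs₁, t₁, rfl⟩ := exists_degreeLT_add_pow_mul hm (q - b) s
  have hs' := congrArg ι hs
  simp only [map_add, map_sub, map_mul, map_pow] at hs'
  have h2 : u ^ 2 * ι (a₂ - s₀ * d₂ - h * t₀ - s₁ * v) ∈ I := by
    convert I.sub_mem h1 (I.mul_mem_left (ι s₁) hg₁) using 1
    simp only [map_sub, map_mul]
    linear_combination -u * hs' - u * ι t₁ * eb - ι t₁ * hu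
  obtain ⟨s, hs2⟩ := (hI.tor2 _).1 h2
  obtain ⟨s₂, hs₂, t₂, rfl⟩ := exists_degreeLT_add_pow_mul hm (q - c) s
  have hs2' := congrArg ι hs2
  simp only [map_add, map_sub, map_mul, map_pow] at hs2'
  refine ⟨s₀, hs₀, s₁, hs₁, s₂, hs₂, ?_⟩
  simp only [map_add, map_mul, map_pow]
  linear_combination ι t₀ * ea + ι t₀ * hq + u * hs' + u * ι t₁ * eb + ι t₁ * hu
    + u ^ 2 * hs2' + u ^ 2 * ι t₂ * ec + u * ι t₂ * hu

lemma eq_zero_of_combination_eq_zero (hm : f.Monic) {d₁ d₂ v s₀ s₁ s₂ : F[X]}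
    (hs₀ : s₀ ∈ degreeLT F (f.natDegree * (q - a)))
    (hs₁ : s₁ ∈ degreeLT F (f.natDegree * (q - b)))
    (hs₂ : s₂ ∈ degreeLT F (f.natDegree * (q - c)))
    (h0 : ι s₀ * (ι f ^ a + u * ι d₁ + u ^ 2 * ι d₂) + ι s₁ * (u * ι f ^ b + u ^ 2 * ι v)
      + ι s₂ * (u ^ 2 * ι f ^ c) = 0) : s₀ = 0 ∧ s₁ = 0 ∧ s₂ = 0 := by
  have ha := hI.a_le_q
  have hb := hI.b_le_a.trans ha
  have hc := hI.c_le_b.trans hb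
  have key {k : ℕ} (hk : k ≤ q) {s : F[X]} (hs : s ∈ degreeLT F (f.natDegree * (q - k)))
      (hd : f ^ q ∣ f ^ k * s) : s = 0 := by
    refine eq_zero_of_pow_dvd_of_mem_degreeLT hm hs ?_
    rw [← Nat.add_sub_cancel' hk, pow_add] at hd
    simpa using (mul_dvd_mul_iff_left (hm.pow k).ne_zero).1 hd
  obtain ⟨g, hg, -, -⟩ := (hK.eq_zero_iff (f ^ a * s₀) (s₀ * d₁ + f ^ b * s₁)
    (s₀ * d₂ + s₁ * v + f ^ c * s₂)).1 (by
      simp only [map_add, map_mul, map_pow]; linear_combination h0)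
  obtain rfl := key ha hs₀ ⟨g, hg⟩
  obtain ⟨h1, -⟩ := (hK.eq_zero_iff' hm.ne_zero (f ^ b * s₁) (s₁ * v + f ^ c * s₂)).1 (by
      simp only [map_add, map_mul, map_pow, map_zero] at h0 ⊢; linear_combination h0)
  obtain rfl := key hb hs₁ h1
  have h2 := (hK.u_sq_mul_eq_zero_iff hm.ne_zero (f ^ c * s₂)).1 (by
      simp only [map_mul, map_pow, map_zero] at h0 ⊢; linear_combination h0)
  exact ⟨rfl, rfl, key hc hs₂ h2⟩

omit hK in
lemma exists_generators : ∃ d₁ d₂ v : F[X],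
    ι f ^ a + u * ι d₁ + u ^ 2 * ι d₂ ∈ I ∧ u * ι f ^ b + u ^ 2 * ι v ∈ I := by
  obtain ⟨d₁, d₂, h0⟩ := (hI.res (f ^ a)).2 dvd_rfl
  obtain ⟨v, h1⟩ := (hI.tor (f ^ b)).2 dvd_rfl
  exact ⟨d₁, d₂, v, by simpa using h0, by simpa using h1⟩

omit hK in
lemma u_sq_mul_pow_mem : u ^ 2 * ι f ^ c ∈ I := by
  simpa using (hI.tor2 (f ^ c)).2 dvd_rfl

/-- Bounded-degree coefficients exist and are unique, so `I` is in bijection with a product of three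
spaces of polynomials, of dimensions `deg f` times `q - a`, `q - b`, `q - c`. -/
lemma natCard_eq (hm : f.Monic) :
    Nat.card I = Nat.card F ^ (f.natDegree * (3 * q - a - b - c)) := by
  have ha := hI.a_le_q
  have hb := hI.b_le_a.trans ha
  have hc := hI.c_le_b.trans hb
  obtain ⟨d₁, d₂, v, hg₀, hg₁⟩ := exists_generators hI
  let φ : degreeLT F (f.natDegree * (q - a)) × degreeLT F (f.natDegree * (q - b)) ×
      degreeLT F (f.natDegree * (q - c)) → I := fun s =>
    ⟨ι s.1 * (ι f ^ a + u * ι d₁ + u ^ 2 * ι d₂) + ι s.2.1 * (u * ι f ^ b + u ^ 2 * ι v)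
      + ι s.2.2 * (u ^ 2 * ι f ^ c), I.add_mem (I.add_mem (I.mul_mem_left _ hg₀)
        (I.mul_mem_left _ hg₁)) (I.mul_mem_left _ (u_sq_mul_pow_mem hI))⟩
  have hφ : Function.Bijective φ := by
    constructor
    · rintro ⟨⟨s₀, hs₀⟩, ⟨s₁, hs₁⟩, ⟨s₂, hs₂⟩⟩ ⟨⟨r₀, hr₀⟩, ⟨r₁, hr₁⟩, ⟨r₂, hr₂⟩⟩ hsr
      have hsr' := congrArg Subtype.val hsr
      simp only [φ] at hsr'
      obtain ⟨e0, e1, e2⟩ := hK.eq_zero_of_combination_eq_zero hI hm (d₁ := d₁) (d₂ := d₂) (v := v)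
        (sub_mem hs₀ hr₀) (sub_mem hs₁ hr₁) (sub_mem hs₂ hr₂) (by
          simp only [map_sub]; linear_combination hsr')
      rw [sub_eq_zero] at e0 e1 e2
      subst e0 e1 e2
      rfl
    · rintro ⟨x, hx⟩
      obtain ⟨s₀, hs₀, s₁, hs₁, s₂, hs₂, rfl⟩ := hK.exists_combination hI hm hg₀ hg₁ hx
      exact ⟨⟨⟨s₀, hs₀⟩, ⟨s₁, hs₁⟩, ⟨s₂, hs₂⟩⟩, rfl⟩
  rw [← Nat.card_congr (Equiv.ofBijective φ hφ), Nat.card_prod, Nat.card_prod, natCard_degreeLT,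
    natCard_degreeLT, natCard_degreeLT, ← pow_add, ← pow_add, ← mul_add, ← mul_add]
  congr 2
  omega

lemma eq_span_triple (hm : f.Monic) {d₁ d₂ v : F[X]}
    (hg₀ : ι f ^ a + u * ι d₁ + u ^ 2 * ι d₂ ∈ I) (hg₁ : u * ι f ^ b + u ^ 2 * ι v ∈ I) :
    I = Ideal.span {ι f ^ a + u * ι d₁ + u ^ 2 * ι d₂, u * ι f ^ b + u ^ 2 * ι v,
      u ^ 2 * ι f ^ c} := by
  refine le_antisymm (fun x hx => ?_) (Ideal.span_le.2 ?_)
  · obtain ⟨s₀, -, s₁, -, s₂, -, rfl⟩ := hK.exists_combination hI hm hg₀ hg₁ hx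
    exact Submodule.mem_span_triple.2 ⟨_, _, _, rfl⟩
  · simp only [Set.insert_subset_iff, Set.singleton_subset_iff, SetLike.mem_coe]
    exact ⟨hg₀, hg₁, u_sq_mul_pow_mem hI⟩

lemma eq_span_pair (hm : f.Monic) (ha : a = q) {v : F[X]} (hg₁ : u * ι f ^ b + u ^ 2 * ι v ∈ I) :
    I = Ideal.span {u * ι f ^ b + u ^ 2 * ι v, u ^ 2 * ι f ^ c} := by
  refine le_antisymm (fun x hx => ?_) (Ideal.span_le.2 ?_)
  · obtain ⟨d₁, d₂, -, hg₀, -⟩ := exists_generators hI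
    obtain ⟨s₀, hs₀, s₁, -, s₂, -, rfl⟩ := hK.exists_combination hI hm hg₀ hg₁ hx
    -- For `a = q` the degree bound is `0`, so the first generator contributes nothing.
    obtain rfl : s₀ = 0 := by
      simpa [ha, mem_degreeLT, Nat.WithBot.lt_zero_iff] using hs₀
    exact Submodule.mem_span_pair.2 ⟨ι s₁, ι s₂, by simp⟩
  · simp only [Set.insert_subset_iff, Set.singleton_subset_iff, SetLike.mem_coe]
    exact ⟨hg₁, u_sq_mul_pow_mem hI⟩

lemma eq_span_singleton (hm : f.Monic) (ha : a = q) (hb : b = q) :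
    I = Ideal.span {u ^ 2 * ι f ^ c} := by
  refine le_antisymm (fun x hx => ?_) ?_
  · obtain ⟨d₁, d₂, v, hg₀, hg₁⟩ := exists_generators hI
    obtain ⟨s₀, hs₀, s₁, hs₁, s₂, -, rfl⟩ := hK.exists_combination hI hm hg₀ hg₁ hx
    obtain rfl : s₀ = 0 := by
      simpa [ha, mem_degreeLT, Nat.WithBot.lt_zero_iff] using hs₀
    obtain rfl : s₁ = 0 := by
      simpa [hb, mem_degreeLT, Nat.WithBot.lt_zero_iff] using hs₁
    exact Ideal.mem_span_singleton'.2 ⟨ι s₂, by simp⟩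
  · rw [Ideal.span_singleton_le_iff_mem]
    exact u_sq_mul_pow_mem hI

end Generators

end IsPresentation

/-! ### Annihilators -/

lemma mem_annihilator_span_iff {K : Type*} [CommRing K] (s : Set K) (x : K) :
    x ∈ (Ideal.span s).annihilator ↔ ∀ y ∈ s, x * y = 0 := by
  simp [Ideal.span, Submodule.mem_annihilator_span]

namespace IsPresentation

variable {F : Type*} [Field F] {f h : F[X]} {q : ℕ} {K : Type*} [CommRing K]
  {ι : F[X] →+* K} {u : K} {I : Ideal K} {a b c : ℕ}

section Annihilators

variable (hK : IsPresentation f h q ι u)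
include hK

lemma rep_mul_u_sq_eq_zero_iff (hf : f ≠ 0) (x₀ x₁ x₂ w : F[X]) :
    (ι x₀ + u * ι x₁ + u ^ 2 * ι x₂) * (u ^ 2 * ι w) = 0 ↔ f ^ q ∣ x₀ * w := by
  rw [← hK.u_sq_mul_eq_zero_iff hf, map_mul]
  refine Eq.congr_left ?_
  linear_combination (ι w * ι x₁ + u * ι w * ι x₂) * hK.u_cube

lemma rep_mul_u_eq_zero_iff (hf : f ≠ 0) (x₀ x₁ x₂ w v : F[X]) :
    (ι x₀ + u * ι x₁ + u ^ 2 * ι x₂) * (u * ι w + u ^ 2 * ι v) = 0 ↔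
      f ^ q ∣ x₀ * w ∧ f ^ q ∣ x₁ * w + x₀ * v := by
  rw [← hK.eq_zero_iff' hf, map_mul, map_add, map_mul, map_mul]
  refine Eq.congr_left ?_
  linear_combination (ι x₂ * ι w + ι x₁ * ι v + u * ι x₂ * ι v) * hK.u_cube

lemma rep_mul_rep_eq_zero_iff (x₀ x₁ x₂ w d₁ d₂ : F[X]) :
    (ι x₀ + u * ι x₁ + u ^ 2 * ι x₂) * (ι w + u * ι d₁ + u ^ 2 * ι d₂) = 0 ↔
      ∃ g, x₀ * w = f ^ q * g ∧ f ^ q ∣ x₁ * w + x₀ * d₁ ∧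
        f ^ q ∣ x₂ * w + x₁ * d₁ + x₀ * d₂ - h * g := by
  rw [← hK.eq_zero_iff]
  simp only [map_mul, map_add]
  refine Eq.congr_left ?_
  linear_combination (ι x₁ * ι d₂ + ι x₂ * ι d₁ + u * ι x₂ * ι d₂) * hK.u_cube

lemma annihilator_span_singleton (hf : f ≠ 0) (hc : c ≤ q) :
    (Ideal.span {u ^ 2 * ι f ^ c}).annihilator = Ideal.span {ι f ^ (q - c), u} := by
  have ec : f ^ (q - c) * f ^ c = f ^ q := by rw [← pow_add, Nat.sub_add_cancel hc]
  ext x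
  obtain ⟨x₀, x₁, x₂, rfl⟩ := hK.exists_rep x
  rw [mem_annihilator_span_iff]
  simp only [Set.mem_singleton_iff, forall_eq, ← map_pow]
  constructor
  · intro hx
    rw [hK.rep_mul_u_sq_eq_zero_iff hf, ← ec, mul_dvd_mul_iff_right (pow_ne_zero _ hf)] at hx
    obtain ⟨y, rfl⟩ := hx
    exact Ideal.mem_span_pair.2 ⟨ι y, ι x₁ + u * ι x₂, by rw [map_mul]; ring⟩
  · rw [Ideal.mem_span_pair]
    rintro ⟨y, z, hx⟩
    have h0 : ι (f ^ (q - c)) * (u ^ 2 * ι (f ^ c)) = 0 := by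
      rw [mul_left_comm, ← map_mul, ec, hK.u_sq_mul_eq_zero_iff hf]
    rw [← hx]
    linear_combination y * h0 + z * ι (f ^ c) * hK.u_cube

/-- Killing `u² f^c` means `x₀ = f^(q-c) y`. Killing the other generator then requires `x₁ f^b ≡ -x₀
v = -y f^b E` modulo `f^q`, so `x₁` is `-y E` up to a multiple of `f^(q-b)`, and `x₂` is free. -/
lemma annihilator_span_pair (hf : f ≠ 0) (hcb : c ≤ b) (hb : b ≤ q) {v E : F[X]}
    (hE : f ^ b * E = f ^ (q - c) * v) :
    (Ideal.span {u * ι f ^ b + u ^ 2 * ι v, u ^ 2 * ι f ^ c}).annihilator =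
      Ideal.span {ι f ^ (q - c) - u * ι E, u * ι f ^ (q - b), u ^ 2} := by
  have ec : f ^ (q - c) * f ^ c = f ^ q := by rw [← pow_add, Nat.sub_add_cancel (hcb.trans hb)]
  have eb : f ^ (q - b) * f ^ b = f ^ q := by rw [← pow_add, Nat.sub_add_cancel hb]
  have ebc : f ^ (b - c) * f ^ c = f ^ b := by rw [← pow_add, Nat.sub_add_cancel hcb]
  apply le_antisymm
  · intro x
    obtain ⟨x₀, x₁, x₂, rfl⟩ := hK.exists_rep x
    rw [mem_annihilator_span_iff]
    simp only [Set.mem_insert_iff, Set.mem_singleton_iff, forall_eq_or_imp, forall_eq, ← map_pow]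
    rw [hK.rep_mul_u_sq_eq_zero_iff hf, hK.rep_mul_u_eq_zero_iff hf]
    rintro ⟨⟨-, k₁, hk₁⟩, hx⟩
    rw [← ec, mul_dvd_mul_iff_right (pow_ne_zero _ hf)] at hx
    obtain ⟨y, rfl⟩ := hx
    have h1 : x₁ = f ^ (q - b) * k₁ - y * E := by
      refine mul_left_cancel₀ (pow_ne_zero b hf) ?_
      linear_combination hk₁ + y * hE - k₁ * eb
    refine Submodule.mem_span_triple.2 ⟨ι y, ι k₁, ι x₂, ?_⟩
    simp only [h1, map_mul, map_sub, smul_eq_mul]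
    ring
  · rw [Ideal.span_le]
    simp only [Set.insert_subset_iff, Set.singleton_subset_iff, SetLike.mem_coe,
      mem_annihilator_span_iff, Set.mem_insert_iff, Set.mem_singleton_iff,
      forall_eq_or_imp, forall_eq, ← map_pow]
    have e0 : ι (f ^ (q - c)) - u * ι E = ι (f ^ (q - c)) + u * ι (-E) + u ^ 2 * ι 0 := by
      simp; ring
    have e1 : u * ι (f ^ (q - b)) = ι 0 + u * ι (f ^ (q - b)) + u ^ 2 * ι 0 := by simp
    have e2 : u ^ 2 = ι 0 + u * ι 0 + u ^ 2 * ι 1 := by simp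
    refine ⟨⟨?_, ?_⟩, ⟨?_, ?_⟩, ?_, ?_⟩
    · rw [e0, hK.rep_mul_u_eq_zero_iff hf]
      exact ⟨⟨f ^ (b - c), by linear_combination f ^ (b - c) * ec - f ^ (q - c) * ebc⟩,
        ⟨0, by linear_combination -hE⟩⟩
    · rw [e0, hK.rep_mul_u_sq_eq_zero_iff hf, ec]
    · rw [e1, hK.rep_mul_u_eq_zero_iff hf]
      exact ⟨by simp, by simp [eb]⟩
    · rw [e1, hK.rep_mul_u_sq_eq_zero_iff hf]
      simp
    · linear_combination (ι (f ^ b) + u * ι v) * hK.u_cube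
    · linear_combination u * ι (f ^ c) * hK.u_cube

/-- The coefficients `x₀` and `x₁` are found as for two generators. In the equation for the `u²`
coefficient of `x g₀` every term is divisible by `f^a` once `hB` is used, and cancelling `f^a`
determines `x₂` modulo `f^(q-a)`. The hypothesis `hd` serves the reverse inclusion. -/
lemma annihilator_span_triple (hf : f ≠ 0) (hcb : c ≤ b) (hba : b ≤ a) (ha : a ≤ q)
    {v d₁ d₂ E H B : F[X]} (hE : f ^ b * E = f ^ (q - c) * v) (hH : f ^ b * H = f ^ (q - a) * d₁)
    (hd : f ^ c ∣ d₁ - f ^ (a - b) * v)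
    (hB : f ^ q ∣ h + H * v - f ^ (q - a) * d₂ - f ^ c * B) :
    (Ideal.span {ι f ^ a + u * ι d₁ + u ^ 2 * ι d₂, u * ι f ^ b + u ^ 2 * ι v,
        u ^ 2 * ι f ^ c}).annihilator =
      Ideal.span {ι f ^ (q - c) - u * ι E + u ^ 2 * ι B, u * ι f ^ (q - b) - u ^ 2 * ι H,
        u ^ 2 * ι f ^ (q - a)} := by
  have hb := hba.trans ha
  have ec : f ^ (q - c) * f ^ c = f ^ q := by rw [← pow_add, Nat.sub_add_cancel (hcb.trans hb)]
  have eb : f ^ (q - b) * f ^ b = f ^ q := by rw [← pow_add, Nat.sub_add_cancel hb]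
  have ea : f ^ (q - a) * f ^ a = f ^ q := by rw [← pow_add, Nat.sub_add_cancel ha]
  have ebc : f ^ (b - c) * f ^ c = f ^ b := by rw [← pow_add, Nat.sub_add_cancel hcb]
  have eab : f ^ (a - b) * f ^ b = f ^ a := by rw [← pow_add, Nat.sub_add_cancel hba]
  have eac : f ^ (a - c) * f ^ c = f ^ a := by
    rw [← pow_add, Nat.sub_add_cancel (hcb.trans hba)]
  have eca : f ^ (a - c) * f ^ (q - a) = f ^ (q - c) := by
    rw [← pow_add]; congr 1; omega
  have hHa : f ^ a * H = f ^ (q - b) * d₁ := by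
    refine mul_left_cancel₀ (pow_ne_zero b hf) ?_
    linear_combination f ^ a * hH + d₁ * ea - d₁ * eb
  have hEH : E * d₁ = f ^ (a - c) * H * v := by
    refine mul_left_cancel₀ (pow_ne_zero b hf) ?_
    linear_combination d₁ * hE - f ^ (a - c) * v * hH - v * d₁ * eca
  obtain ⟨k, hk⟩ := hB
  obtain ⟨l, hl⟩ := hd
  apply le_antisymm
  · intro x
    obtain ⟨x₀, x₁, x₂, rfl⟩ := hK.exists_rep x
    rw [mem_annihilator_span_iff]
    simp only [Set.mem_insert_iff, Set.mem_singleton_iff, forall_eq_or_imp, forall_eq, ← map_pow]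
    rw [hK.rep_mul_u_sq_eq_zero_iff hf, hK.rep_mul_u_eq_zero_iff hf, hK.rep_mul_rep_eq_zero_iff]
    rintro ⟨⟨g, hg, -, k₂, hk₂⟩, ⟨-, k₁, hk₁⟩, hx⟩
    rw [← ec, mul_dvd_mul_iff_right (pow_ne_zero _ hf)] at hx
    obtain ⟨y, rfl⟩ := hx
    have h1 : x₁ = f ^ (q - b) * k₁ - y * E := by
      refine mul_left_cancel₀ (pow_ne_zero b hf) ?_
      linear_combination hk₁ + y * hE - k₁ * eb
    have h2 : g = f ^ (a - c) * y := by
      refine mul_left_cancel₀ (pow_ne_zero q hf) ?_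
      -- Here `x₀ f^a = f^(q-c) y f^a = f^q f^(a-c) y`, so `h` enters the last equation multiplied
      -- by `f^(a-c) y`.
      linear_combination -hg - y * f ^ (q - c) * eac + f ^ (a - c) * y * ec
    subst h1 h2
    have h3 : x₂ = y * B - H * k₁ + f ^ (q - a) * (k₂ + y * f ^ (a - c) * k) := by
      refine mul_left_cancel₀ (pow_ne_zero a hf) ?_
      linear_combination hk₂ + y * hEH + k₁ * hHa + y * d₂ * eca
        + y * f ^ (a - c) * hk + y * B * eac - (k₂ + y * f ^ (a - c) * k) * ea
    refine Submodule.mem_span_triple.2 ⟨ι y, ι k₁, ι (k₂ + y * f ^ (a - c) * k), ?_⟩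
    simp only [h3, map_mul, map_sub, map_add, map_pow, smul_eq_mul]
    ring
  · rw [Ideal.span_le]
    simp only [Set.insert_subset_iff, Set.singleton_subset_iff, SetLike.mem_coe,
      mem_annihilator_span_iff, Set.mem_insert_iff, Set.mem_singleton_iff,
      forall_eq_or_imp, forall_eq, ← map_pow]
    have e0 : ι (f ^ (q - c)) - u * ι E + u ^ 2 * ι B =
        ι (f ^ (q - c)) + u * ι (-E) + u ^ 2 * ι B := by
      rw [map_neg]; ring
    have e1 : u * ι (f ^ (q - b)) - u ^ 2 * ι H =
        ι 0 + u * ι (f ^ (q - b)) + u ^ 2 * ι (-H) := by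
      rw [map_neg, map_zero]; ring
    have e2 : u ^ 2 * ι (f ^ (q - a)) = ι 0 + u * ι 0 + u ^ 2 * ι (f ^ (q - a)) := by simp
    refine ⟨⟨?_, ?_, ?_⟩, ⟨?_, ?_, ?_⟩, ?_, ?_, ?_⟩
    · rw [e0, hK.rep_mul_rep_eq_zero_iff]
      refine ⟨f ^ (a - c), ?_, ⟨l, ?_⟩, ⟨-(f ^ (a - c) * k), ?_⟩⟩
      · linear_combination f ^ (a - c) * ec - f ^ (q - c) * eac
      -- The `u` coefficient is `f^(q-c) (d₁ - f^(a-b) v)`, and `hd` supplies the missing `f^c`.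
      · linear_combination f ^ (a - b) * (-hE) + E * eab + f ^ (q - c) * hl + l * ec
      · linear_combination -B * eac - hEH - d₂ * eca - f ^ (a - c) * hk
    · rw [e0, hK.rep_mul_u_eq_zero_iff hf]
      exact ⟨⟨f ^ (b - c), by linear_combination f ^ (b - c) * ec - f ^ (q - c) * ebc⟩,
        ⟨0, by linear_combination -hE⟩⟩
    · rw [e0, hK.rep_mul_u_sq_eq_zero_iff hf, ec]
    · rw [e1, hK.rep_mul_rep_eq_zero_iff]
      refine ⟨0, by ring, ⟨f ^ (a - b), ?_⟩, ⟨0, ?_⟩⟩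
      · linear_combination f ^ (a - b) * eb - f ^ (q - b) * eab
      · linear_combination -hHa
    · rw [e1, hK.rep_mul_u_eq_zero_iff hf]
      exact ⟨by simp, by simp [eb]⟩
    · rw [e1, hK.rep_mul_u_sq_eq_zero_iff hf]
      simp
    · rw [e2, hK.rep_mul_rep_eq_zero_iff]
      exact ⟨0, by ring, by simp, by simp [ea]⟩
    · rw [e2, hK.rep_mul_u_eq_zero_iff hf]
      simp
    · rw [e2, hK.rep_mul_u_sq_eq_zero_iff hf]
      simp

end Annihilators

/-! ### Constraints on the coefficients of the generators -/

section Consistency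

variable (hK : IsPresentation f h q ι u) (hI : TorsionExponents f q ι u I a b c)
  {v d₁ d₂ H : F[X]} (hg₀ : ι f ^ a + u * ι d₁ + u ^ 2 * ι d₂ ∈ I)
  (hg₁ : u * ι f ^ b + u ^ 2 * ι v ∈ I)
include hK hI

include hg₁ in
-- Multiplying `g₁` by `f^(q-b)` turns its leading term into `u f^q = 0`, leaving `u² f^(q-b) v` in
-- `I`.
lemma pow_dvd_pow_mul_of_mem : f ^ c ∣ f ^ (q - b) * v := by
  have eb : ι f ^ (q - b) * ι f ^ b = ι f ^ q := by
    rw [← pow_add, Nat.sub_add_cancel (hI.b_le_a.trans hI.a_le_q)]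
  rw [← hI.tor2]
  convert I.mul_mem_left (ι f ^ (q - b)) hg₁ using 1
  rw [map_mul, map_pow]
  linear_combination -u * eb - hK.u_mul_pow

include hg₀ in
-- Multiplying `g₀` by `f^(q-a)` turns its leading term into `f^q = -u² h`, so the product starts at
-- level `u`.
lemma pow_dvd_pow_mul_of_mem' : f ^ b ∣ f ^ (q - a) * d₁ := by
  have ea : ι f ^ (q - a) * ι f ^ a = ι f ^ q := by
    rw [← pow_add, Nat.sub_add_cancel hI.a_le_q]
  refine (hI.tor _).1 ⟨f ^ (q - a) * d₂ - h, ?_⟩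
  convert I.mul_mem_left (ι f ^ (q - a)) hg₀ using 1
  rw [map_sub, map_mul, map_mul, map_pow]
  linear_combination -ea - hK.pow_eq

include hg₀ hg₁

/-- In `u g₀ - f^(a-b) g₁` the terms `u f^a` cancel and only the `u²` level survives. -/
lemma pow_dvd_sub : f ^ c ∣ d₁ - f ^ (a - b) * v := by
  have eab : ι f ^ (a - b) * ι f ^ b = ι f ^ a := by
    rw [← pow_add, Nat.sub_add_cancel hI.b_le_a]
  rw [← hI.tor2]
  convert I.sub_mem (I.mul_mem_left u hg₀) (I.mul_mem_left (ι f ^ (a - b)) hg₁) using 1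
  rw [map_sub, map_mul, map_pow]
  linear_combination u * eab - ι d₂ * hK.u_cube

/-- In `H g₁ - f^(q-a) g₀` the `u` terms cancel by the choice of `H`, and `-f^q = u² h` contributes
the summand `h`. -/
lemma pow_dvd_defect (hH : f ^ b * H = f ^ (q - a) * d₁) :
    f ^ c ∣ h + H * v - f ^ (q - a) * d₂ := by
  have ea : ι f ^ (q - a) * ι f ^ a = ι f ^ q := by
    rw [← pow_add, Nat.sub_add_cancel hI.a_le_q]
  have hH' := congrArg ι hH
  rw [map_mul, map_mul, map_pow, map_pow] at hH'
  rw [← hI.tor2]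
  convert I.sub_mem (I.mul_mem_left (ι H) hg₁) (I.mul_mem_left (ι f ^ (q - a)) hg₀) using 1
  simp only [map_sub, map_add, map_mul, map_pow]
  linear_combination -u * hH' + ea + hK.pow_eq

end Consistency

end IsPresentation

/-! ### Comparison with the residue and torsion sets in `F[x] / ⟨f^q⟩` -/

section Exponents

variable {F : Type*} [Field F] {f h : F[X]} {q : ℕ}

lemma toRes_eq_iff (x y : F[X]) : toRes f q x = toRes f q y ↔ f ^ q ∣ x - y :=
  AdjoinRoot.mk_eq_mk

lemma toRes_mem_span_iff {k : ℕ} (hk : k ≤ q) (x : F[X]) :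
    toRes f q x ∈ Ideal.span {toRes f q f ^ k} ↔ f ^ k ∣ x := by
  rw [Ideal.mem_span_singleton]
  constructor
  · rintro ⟨y, hy⟩
    obtain ⟨y, rfl⟩ : ∃ z, toRes f q z = y := AdjoinRoot.mk_surjective y
    rw [← map_pow, ← map_mul, toRes_eq_iff] at hy
    exact (dvd_sub_left (dvd_mul_right _ _)).1 ((pow_dvd_pow f hk).trans hy)
  · rintro ⟨y, rfl⟩
    rw [map_mul, map_pow]
    exact dvd_mul_right _ _

lemma eq_span_iff {k : ℕ} (hk : k ≤ q) (S : Set (ResRing f q)) :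
    S = ↑(Ideal.span {toRes f q f ^ k} : Ideal (ResRing f q)) ↔
      ∀ x, toRes f q x ∈ S ↔ f ^ k ∣ x := by
  rw [Set.ext_iff, (show Function.Surjective (toRes f q) from AdjoinRoot.mk_surjective).forall]
  simp only [SetLike.mem_coe, toRes_mem_span_iff hk]

lemma exists_toRes_eq (hm : f.Monic) (x : F[X]) :
    ∃ w ∈ degreeLT F (f.natDegree * q), ∃ s, x = w + f ^ q * s ∧ toRes f q x = toRes f q w := by
  obtain ⟨w, hw, s, hs⟩ := exists_degreeLT_add_pow_mul hm q x
  exact ⟨w, hw, s, hs, (toRes_eq_iff _ _).2 ⟨s, by rw [hs]; ring⟩⟩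

lemma toRes_mem_torU2_iff (hm : f.Monic) (I : Ideal (KRing f h q)) (x : F[X]) :
    toRes f q x ∈ torU2 I ↔ uK f h q ^ 2 * toK f h q x ∈ I := by
  have hK := isPresentation f h q
  constructor
  · rintro ⟨y, -, hxy, hy⟩
    obtain ⟨s, hs⟩ := (toRes_eq_iff _ _).1 hxy
    have hs' := congrArg (toK f h q) hs
    rw [map_sub, map_mul, map_pow] at hs'
    convert hy using 1
    linear_combination uK f h q ^ 2 * hs' + uK f h q * toK f h q s * hK.u_mul_pow
  · intro hx
    obtain ⟨w, hw, s, rfl, h1⟩ := exists_toRes_eq (q := q) hm x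
    refine ⟨w, hw, h1, ?_⟩
    convert hx using 1
    rw [map_add, map_mul, map_pow]
    linear_combination -uK f h q * toK f h q s * hK.u_mul_pow

lemma toRes_mem_torU_iff (hm : f.Monic) (I : Ideal (KRing f h q)) (x : F[X]) :
    toRes f q x ∈ torU I ↔
      ∃ a₂, uK f h q * toK f h q x + uK f h q ^ 2 * toK f h q a₂ ∈ I := by
  have hK := isPresentation f h q
  constructor
  · rintro ⟨y, -, a₂, -, hxy, hy⟩
    obtain ⟨s, hs⟩ := (toRes_eq_iff _ _).1 hxy
    have hs' := congrArg (toK f h q) hs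
    rw [map_sub, map_mul, map_pow] at hs'
    refine ⟨a₂, ?_⟩
    convert hy using 1
    linear_combination uK f h q * hs' + toK f h q s * hK.u_mul_pow
  · rintro ⟨a₂, hx⟩
    obtain ⟨w, hw, s, rfl, h1⟩ := exists_toRes_eq (q := q) hm x
    obtain ⟨w', hw', s', rfl, -⟩ := exists_toRes_eq (q := q) hm a₂
    refine ⟨w, hw, w', hw', h1, ?_⟩
    convert hx using 1
    simp only [map_add, map_mul, map_pow]
    linear_combination (-toK f h q s - uK f h q * toK f h q s') * hK.u_mul_pow

lemma toRes_mem_resU_iff (hm : f.Monic) (I : Ideal (KRing f h q)) (x : F[X]) :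
    toRes f q x ∈ resU I ↔
      ∃ a₁ a₂, toK f h q x + uK f h q * toK f h q a₁ + uK f h q ^ 2 * toK f h q a₂ ∈ I := by
  have hK := isPresentation f h q
  constructor
  · rintro ⟨y, -, a₁, -, a₂, -, hxy, hy⟩
    obtain ⟨s, hs⟩ := (toRes_eq_iff _ _).1 hxy
    have hs' := congrArg (toK f h q) hs
    rw [map_sub, map_mul, map_pow] at hs'
    -- Changing the constant coefficient by `f^q s = -u² h s` is compensated at level `u²`.
    refine ⟨a₁, a₂ + h * s, ?_⟩
    convert hy using 1
    rw [map_add, map_mul]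
    linear_combination hs' + toK f h q s * hK.pow_eq
  · rintro ⟨a₁, a₂, hx⟩
    obtain ⟨w, hw, s, rfl, h1⟩ := exists_toRes_eq (q := q) hm x
    obtain ⟨w₁, hw₁, s₁, rfl, -⟩ := exists_toRes_eq (q := q) hm a₁
    obtain ⟨w₂, hw₂, s₂, hs₂, -⟩ := exists_toRes_eq (q := q) hm (a₂ - h * s)
    refine ⟨w, hw, w₁, hw₁, w₂, hw₂, h1, ?_⟩
    have hs' := congrArg (toK f h q) hs₂
    simp only [map_sub, map_add, map_mul, map_pow] at hs'
    convert hx using 1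
    simp only [map_add, map_mul, map_pow]
    linear_combination (-toK f h q s₁ - uK f h q * toK f h q s₂) * hK.u_mul_pow
      - toK f h q s * hK.pow_eq - uK f h q ^ 2 * hs'

lemma hasExponents_iff (hm : f.Monic) (I : Ideal (KRing f h q)) (a b c : ℕ) :
    HasExponents I a b c ↔ TorsionExponents f q (toK f h q) (uK f h q) I a b c := by
  constructor
  · rintro ⟨h1, h2, h3, h4, h5, h6⟩
    rw [eq_span_iff (by omega)] at h4 h5 h6
    simp only [toRes_mem_resU_iff hm] at h4
    simp only [toRes_mem_torU_iff hm] at h5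
    simp only [toRes_mem_torU2_iff hm] at h6
    exact ⟨h1, h2, h3, h4, h5, h6⟩
  · rintro ⟨h1, h2, h3, h4, h5, h6⟩
    refine ⟨h1, h2, h3, ?_, ?_, ?_⟩ <;> rw [eq_span_iff (by omega)]
    · simpa only [toRes_mem_resU_iff hm] using h4
    · simpa only [toRes_mem_torU_iff hm] using h5
    · simpa only [toRes_mem_torU2_iff hm] using h6

end Exponents

/-! ### Normalised presentations of Types II and III -/

section Presentations

variable {F : Type*} [Field F] {f h : F[X]} {q : ℕ}

lemma isZeroOrUnitForm_zero (N : ℕ) : IsZeroOrUnitForm f h q N 0 :=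
  ⟨Or.inl rfl, 0, fun _ => zero_mem _, by simp⟩

/-- Reduce `v` modulo `f^c` and extract the full power of `f`. The cofactor is prime to `f`, hence a
unit, and its degree is below `(c - θ) deg f`, which gives the length of its expansion. -/
lemma exists_normal_form (hf : Irreducible f) (hm : f.Monic) (h : F[X]) (q c : ℕ) (v : F[X]) :
    ∃ (θ : ℕ) (V s : F[X]), v = f ^ θ * V + f ^ c * s ∧ (V ≠ 0 → θ < c ∧ ¬ f ∣ V) ∧
      IsZeroOrUnitForm f h q (c - θ) V := by
  obtain ⟨w, hw, s, rfl⟩ := exists_degreeLT_add_pow_mul hm c v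
  by_cases hw0 : w = 0
  · exact ⟨0, 0, s, by simp [hw0], by simp, isZeroOrUnitForm_zero _⟩
  obtain ⟨V, hV, hfV⟩ := (FiniteMultiplicity.of_prime_left hf.prime hw0).exists_eq_pow_mul_and_not_dvd
  set θ := multiplicity f w
  have hV0 : V ≠ 0 := by rintro rfl; exact hfV (dvd_zero _)
  have hdeg : f.natDegree * θ + V.natDegree < f.natDegree * c := by
    rw [mem_degreeLT, degree_eq_natDegree hw0, Nat.cast_lt, hV, (hm.pow θ).natDegree_mul' hV0,
      natDegree_pow] at hw
    linarith
  have hθ : θ < c := lt_of_mul_lt_mul_left (by omega) (Nat.zero_le f.natDegree)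
  refine ⟨θ, V, s, by rw [← hV], fun _ => ⟨hθ, hfV⟩,
    Or.inr ((isPresentation f h q).isUnit_of_not_dvd hf hfV), ?_⟩
  refine exists_base_expansion hm _ _ ?_
  rw [mem_degreeLT, degree_eq_natDegree hV0, Nat.cast_lt, Nat.mul_sub]
  omega

lemma le_of_pow_dvd_pow_mul (hf : Irreducible f) {k l : ℕ} {V : F[X]} (hV : ¬ f ∣ V)
    (hd : f ^ k ∣ f ^ l * V) : k ≤ l :=
  (pow_dvd_pow_iff hf.ne_zero hf.not_isUnit).1
    (((hf.coprime_iff_not_dvd.2 hV).pow_left).dvd_of_dvd_mul_right hd)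

variable {I : Ideal (KRing f h q)} {a b c : ℕ}
  (hI : TorsionExponents f q (toK f h q) (uK f h q) I a b c)
include hI

lemma exists_second_generator (hf : Irreducible f) (hm : f.Monic) :
    ∃ (θ : ℕ) (V : F[X]), (V ≠ 0 → b + c ≤ θ + q ∧ θ < c) ∧ IsZeroOrUnitForm f h q (c - θ) V ∧
      uK f h q * toK f h q f ^ b + uK f h q ^ 2 * toK f h q (f ^ θ * V) ∈ I := by
  have hK := isPresentation f h q
  obtain ⟨-, -, v, -, hg₁⟩ := IsPresentation.exists_generators hI
  obtain ⟨θ, V, s, rfl, hV, hform⟩ := exists_normal_form hf hm h q c v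
  have hg : uK f h q * toK f h q f ^ b + uK f h q ^ 2 * toK f h q (f ^ θ * V) ∈ I := by
    convert I.sub_mem hg₁ (I.mul_mem_left (toK f h q s) (IsPresentation.u_sq_mul_pow_mem hI))
      using 1
    simp only [map_add, map_mul, map_pow]
    ring
  refine ⟨θ, V, fun hV0 => ⟨?_, (hV hV0).1⟩, hform, hg⟩
  -- Since `V` is prime to `f`, divisibility of `f^(q-b+θ) V` by `f^c` is the lower bound on `θ`.
  have h1 := hK.pow_dvd_pow_mul_of_mem hI hg
  rw [← mul_assoc, ← pow_add] at h1
  have := le_of_pow_dvd_pow_mul hf (hV hV0).2 h1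
  have := hI.b_le_a.trans hI.a_le_q
  omega

lemma exists_isTypeII (hf : Irreducible f) (hm : f.Monic) (ha : a = q) :
    ∃ t G, IsTypeII I b c t G := by
  obtain ⟨t, G, hb, hform, hg⟩ := exists_second_generator hI hf hm
  refine ⟨t, G, fun h0 => by rw [add_comm c]; exact hb h0, hform, ?_⟩
  have := (isPresentation f h q).eq_span_pair hI hm ha hg
  simpa only [map_mul, map_pow, mul_assoc] using this

lemma exists_isTypeIII (hf : Irreducible f) (hm : f.Monic) :
    ∃ t₁ t₂ θ D₁ D₂ V, IsTypeIII I a b c t₁ t₂ θ D₁ D₂ V := by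
  have hK := isPresentation f h q
  obtain ⟨θ, V, hbθ, hformV, hg₁⟩ := exists_second_generator hI hf hm
  obtain ⟨d₁, d₂, -, hg₀, -⟩ := IsPresentation.exists_generators hI
  obtain ⟨t₁, D₁, s₁, rfl, hD₁, hform₁⟩ := exists_normal_form hf hm h q b d₁
  -- Reducing `d₁` modulo `f^b` subtracts `s₁` times the second generator and alters `d₂`; only the
  -- altered `d₂` is normalised.
  obtain ⟨t₂, D₂, s₂, hs₂, hD₂, hform₂⟩ :=
    exists_normal_form hf hm h q c (d₂ - s₁ * (f ^ θ * V))
  have hg : toK f h q f ^ a + uK f h q * toK f h q (f ^ t₁ * D₁)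
      + uK f h q ^ 2 * toK f h q (f ^ t₂ * D₂) ∈ I := by
    convert I.sub_mem (I.sub_mem hg₀ (I.mul_mem_left (toK f h q s₁) hg₁))
      (I.mul_mem_left (toK f h q s₂) (IsPresentation.u_sq_mul_pow_mem hI)) using 1
    have hs := congrArg (toK f h q) hs₂
    simp only [map_sub, map_add, map_mul, map_pow] at hs ⊢
    linear_combination -uK f h q ^ 2 * hs
  refine ⟨t₁, t₂, θ, D₁, D₂, V, fun h0 => ⟨?_, (hD₁ h0).1⟩, fun h0 => (hD₂ h0).1, hbθ, hform₁,
    hform₂, hformV, ?_⟩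
  · have h1 := hK.pow_dvd_pow_mul_of_mem' hI hg
    rw [← mul_assoc, ← pow_add] at h1
    have := le_of_pow_dvd_pow_mul hf (hD₁ h0).2 h1
    have := hI.a_le_q
    omega
  · have := hK.eq_span_triple hI hm hg hg₁
    simpa only [map_mul, map_pow, mul_assoc] using this

lemma IsTypeII.annihilator_eq (hf : f ≠ 0) {t : ℕ} {G : F[X]} (hG : IsTypeII I b c t G) :
    I.annihilator = Ideal.span
      {toK f h q f ^ (q - c) - uK f h q * toK f h q f ^ (q - c + t - b) * toK f h q G,
        uK f h q * toK f h q f ^ (q - b), uK f h q ^ 2} := by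
  have hb := hI.b_le_a.trans hI.a_le_q
  have hcb := hI.c_le_b
  -- The bound on `t` makes the truncated exponent the true one when `G ≠ 0`; for `G = 0` the
  -- exponent is immaterial.
  have hE : f ^ b * (f ^ (q - c + t - b) * G) = f ^ (q - c) * (f ^ t * G) := by
    by_cases h0 : G = 0
    · simp [h0]
    · rw [← mul_assoc, ← mul_assoc, ← pow_add, ← pow_add]
      congr 2
      have := hG.bound h0
      omega
  have := (isPresentation f h q).annihilator_span_pair hf hcb hb hE
  simp only [map_mul, map_pow, ← mul_assoc] at this
  rw [← this, ← hG.eq_span]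

variable {t₁ t₂ θ : ℕ} {D₁ D₂ V : F[X]} (hD : IsTypeIII I a b c t₁ t₂ θ D₁ D₂ V)
include hD

omit hI in
lemma IsTypeIII.mem : toK f h q f ^ a + uK f h q * toK f h q (f ^ t₁ * D₁)
      + uK f h q ^ 2 * toK f h q (f ^ t₂ * D₂) ∈ I ∧
    uK f h q * toK f h q f ^ b + uK f h q ^ 2 * toK f h q (f ^ θ * V) ∈ I := by
  rw [hD.eq_span]
  simp only [map_mul, map_pow, ← mul_assoc]
  exact ⟨Ideal.subset_span (by simp), Ideal.subset_span (by simp)⟩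

lemma IsTypeIII.mul_eq : f ^ b * (f ^ (q - a + t₁ - b) * D₁) = f ^ (q - a) * (f ^ t₁ * D₁) := by
  by_cases h0 : D₁ = 0
  · simp [h0]
  · rw [← mul_assoc, ← mul_assoc, ← pow_add, ← pow_add]
    congr 2
    have := hD.bound₁ h0
    have := hI.a_le_q
    omega

omit hI hD in
lemma defect_eq : defect f h q a b t₁ t₂ θ D₁ D₂ V = uK f h q ^ 2 * toK f h q
    (h + (f ^ (q - a + t₁ - b) * D₁) * (f ^ θ * V) - f ^ (q - a) * (f ^ t₂ * D₂)) := by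
  simp only [defect, map_sub, map_add, map_mul, map_pow, pow_add]
  ring

lemma IsTypeIII.exists_defect_eq (hm : f.Monic) : ∃ B ∈ degreeLT F (f.natDegree * q),
    defect f h q a b t₁ t₂ θ D₁ D₂ V = uK f h q ^ 2 * toK f h q f ^ c * toK f h q B := by
  have hK := isPresentation f h q
  obtain ⟨B, hB⟩ := hK.pow_dvd_defect hI (hD.mem).1 (hD.mem).2 (hD.mul_eq hI)
  -- Reducing `B` modulo `f^q` does not change `u² f^c B`, as `u f^q = 0`.
  obtain ⟨w, hw, s, rfl⟩ := exists_degreeLT_add_pow_mul hm q B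
  refine ⟨w, hw, ?_⟩
  rw [defect_eq, hB]
  simp only [map_add, map_mul, map_pow]
  linear_combination uK f h q * toK f h q f ^ c * toK f h q s * hK.u_mul_pow

lemma IsTypeIII.annihilator_eq (hf : f ≠ 0) {B : F[X]}
    (hB : defect f h q a b t₁ t₂ θ D₁ D₂ V = uK f h q ^ 2 * toK f h q f ^ c * toK f h q B) :
    I.annihilator = Ideal.span
      {toK f h q f ^ (q - c) - uK f h q * toK f h q f ^ (q - c + θ - b) * toK f h q V
          + uK f h q ^ 2 * toK f h q B,
        uK f h q * toK f h q f ^ (q - b)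
          - uK f h q ^ 2 * toK f h q f ^ (q - a + t₁ - b) * toK f h q D₁,
        uK f h q ^ 2 * toK f h q f ^ (q - a)} := by
  have hK := isPresentation f h q
  have ha := hI.a_le_q
  have hba := hI.b_le_a
  have hcb := hI.c_le_b
  have hE : f ^ b * (f ^ (q - c + θ - b) * V) = f ^ (q - c) * (f ^ θ * V) := by
    by_cases h0 : V = 0
    · simp [h0]
    · rw [← mul_assoc, ← mul_assoc, ← pow_add, ← pow_add]
      congr 2
      have := hD.bound₃ h0
      omega
  have hd := hK.pow_dvd_sub hI (hD.mem).1 (hD.mem).2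
  have hB' : f ^ q ∣ h + (f ^ (q - a + t₁ - b) * D₁) * (f ^ θ * V) - f ^ (q - a) * (f ^ t₂ * D₂)
      - f ^ c * B := by
    rw [← hK.u_sq_mul_eq_zero_iff hf, map_sub, mul_sub, ← defect_eq, hB, map_mul, map_pow,
      mul_assoc, sub_self]
  have := hK.annihilator_span_triple hf hcb hba ha hE (hD.mul_eq hI) hd hB'
  simp only [map_mul, map_pow, ← mul_assoc] at this
  rw [← this, ← hD.eq_span]

end Presentations

/-! ### Existence and coprimality of the `h_j` -/

section Factorization

lemma prod_add_mul_of_sq_eq_zero {ι K : Type*} [DecidableEq ι] [CommRing K] {w : K}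
    (hw : w ^ 2 = 0) (A B : ι → K) (s : Finset ι) :
    ∏ j ∈ s, (A j + w * B j) = ∏ j ∈ s, A j + w * ∑ j ∈ s, B j * ∏ i ∈ s.erase j, A i := by
  induction s using Finset.induction_on with
  | empty => simp
  | insert k s hk ih =>
    have h1 : ∑ j ∈ s, B j * ∏ i ∈ (insert k s).erase j, A i
        = A k * ∑ j ∈ s, B j * ∏ i ∈ s.erase j, A i := by
      rw [Finset.mul_sum]
      refine Finset.sum_congr rfl fun j hj => ?_
      rw [Finset.erase_insert_of_ne (by rintro rfl; exact hk hj),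
        Finset.prod_insert (by simp [hk])]
      ring
    rw [Finset.prod_insert hk, ih, Finset.prod_insert hk, Finset.sum_insert hk,
      Finset.erase_insert hk, h1]
    linear_combination B k * (∑ j ∈ s, B j * ∏ i ∈ s.erase j, A i) * hw

variable {F : Type*} [Field F] {ι : Type*} [Fintype ι] [DecidableEq ι]

/-- As `u²` squares to zero, the product expands to first order, and only its `u²` coefficient
remains to be compared with `-γ`. -/
lemma factorization_iff (f h : ι → F[X]) (q N : ℕ) (α γ : F)
    (hprod : (X : F[X]) ^ N - C α = ∏ j, f j ^ q) :
    (X : (ChainRing F)[X]) ^ N - C (algebraMap F (ChainRing F) α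
        + algebraMap F (ChainRing F) γ * uR F ^ 2) = ∏ j, kPoly (f j) (h j) q ↔
      ∑ j, h j * ∏ i ∈ Finset.univ.erase j, f i ^ q = -C γ := by
  have hw : (C (uR F ^ 2) : (ChainRing F)[X]) ^ 2 = 0 := by
    rw [← C_pow, ← pow_mul, pow_succ (uR F) 3, uR_cube, zero_mul, C_0]
  have hC (x : F) : C (algebraMap F (ChainRing F) x) = incl F (C x) := by simp [incl]
  have hX : (X : (ChainRing F)[X]) = incl F X := by simp [incl]
  have hR : ∏ j, kPoly (f j) (h j) q = incl F (∏ j, f j ^ q)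
      + C (uR F ^ 2) * incl F (∑ j, h j * ∏ i ∈ Finset.univ.erase j, f i ^ q) := by
    simp only [kPoly]
    rw [prod_add_mul_of_sq_eq_zero hw]
    simp only [map_prod, map_sum, map_mul, map_pow]
  rw [hR, ← hprod, C_add, C_mul, hC, hC, hX, map_sub, map_pow (incl F)]
  constructor
  · intro H
    have := (incl_eq_zero (F := F) (a₀ := 0) (a₁ := 0)
      (a₂ := ∑ j, h j * ∏ i ∈ Finset.univ.erase j, f i ^ q + C γ) (by
        rw [map_zero, map_add, ← C_pow]
        linear_combination -H)).2.2
    linear_combination this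
  · intro H
    rw [H, map_neg]
    ring

/-- Every summand with index other than `j` contains `f_j^q`; if `f_j` divided `h_j` too, it would
divide the unit `-γ`. -/
lemma not_dvd_of_factorization (f h : ι → F[X]) {q : ℕ} (hq : q ≠ 0) {γ : F} (hγ : γ ≠ 0)
    (H : ∑ j, h j * ∏ i ∈ Finset.univ.erase j, f i ^ q = -C γ) {j : ι}
    (hf : Irreducible (f j)) : ¬ f j ∣ h j := by
  intro hd
  refine hf.not_isUnit (isUnit_of_dvd_unit (y := -C γ) ?_ (by simpa using hγ))
  rw [← H]
  refine Finset.dvd_sum fun k _ => ?_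
  by_cases hk : k = j
  · subst hk
    exact hd.mul_right _
  · exact ((dvd_pow_self _ hq).trans (Finset.dvd_prod_of_mem (fun i => f i ^ q)
      (by simpa using Ne.symm hk))).mul_left _

/-- Separability makes the powers `f_j^q` pairwise coprime; their Bézout coefficients are scaled by
`-γ`. -/
lemma exists_factorization [Nonempty ι] (f : ι → F[X]) (q : ℕ) (hsep : (∏ j, f j).Separable)
    (γ : F) : ∃ h : ι → F[X], ∑ j, h j * ∏ i ∈ Finset.univ.erase j, f i ^ q = -C γ := by
  have hcop : Pairwise (Function.onFun IsCoprime fun j => f j ^ q) := by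
    intro i j hij
    refine IsCoprime.pow (hsep.of_dvd ?_).isCoprime
    rw [← Finset.mul_prod_erase _ _ (Finset.mem_univ i)]
    exact mul_dvd_mul_left _ (Finset.dvd_prod_of_mem _ (by simpa using hij.symm))
  obtain ⟨μ, hμ⟩ := exists_sum_eq_one_iff_pairwise_coprime'.2 hcop
  refine ⟨fun j => -C γ * μ j, ?_⟩
  calc ∑ j, -C γ * μ j * ∏ i ∈ Finset.univ.erase j, f i ^ q
      = -C γ * ∑ j, μ j * ∏ i ∈ {j}ᶜ, f i ^ q := by
        rw [Finset.mul_sum]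
        exact Finset.sum_congr rfl fun j _ => by rw [mul_assoc, Finset.compl_singleton]
    _ = -C γ := by rw [hμ, mul_one]

end Factorization

end ConstacyclicU3

/-! ### The main theorem -/

theorem mainTheorem3 {F : Type*} [Field F] [Fintype F]
    (p n s m : ℕ) (hp : p.Prime) (hn : 0 < n) (hs : 0 < s) (hm : 0 < m)
    (hnp : Nat.Coprime n p) (hF : Fintype.card F = p ^ m)
    (α α₀ γ : F) (hα : α ≠ 0) (hα₀ : α₀ ^ p ^ s = α) (hγ : γ ≠ 0)
    (r : ℕ) (f : Fin r → F[X])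
    (hmonic : ∀ j, (f j).Monic) (hirr : ∀ j, Irreducible (f j))
    (hprod : (X : F[X]) ^ n - C α₀ = ∏ j, f j) :
    -- the polynomials `h_j(x)` of the factorization of `x^(n p^s) - (α + γ u²)` exist
    (∃ h : Fin r → F[X],
      (X : (ConstacyclicU3.ChainRing F)[X]) ^ (n * p ^ s)
          - C (algebraMap F (ConstacyclicU3.ChainRing F) α
              + algebraMap F (ConstacyclicU3.ChainRing F) γ * ConstacyclicU3.uR F ^ 2)
        = ∏ j, ConstacyclicU3.kPoly (f j) (h j) (p ^ s)) ∧
    ∀ h : Fin r → F[X],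
      (X : (ConstacyclicU3.ChainRing F)[X]) ^ (n * p ^ s)
          - C (algebraMap F (ConstacyclicU3.ChainRing F) α
              + algebraMap F (ConstacyclicU3.ChainRing F) γ * ConstacyclicU3.uR F ^ 2)
        = ∏ j, ConstacyclicU3.kPoly (f j) (h j) (p ^ s) →
    ∀ j : Fin r,
      let q : ℕ := p ^ s
      let d : ℕ := (f j).natDegree
      let u : ConstacyclicU3.KRing (f j) (h j) q := ConstacyclicU3.uK (f j) (h j) q
      let ι : F[X] →+* ConstacyclicU3.KRing (f j) (h j) q := ConstacyclicU3.toK (f j) (h j) q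
      Ideal.span {ι (f j) ^ q} = Ideal.span {u ^ 2} ∧
      ∀ I : Ideal (ConstacyclicU3.KRing (f j) (h j) q), I ≠ ⊥ → I ≠ ⊤ →
        (∃ a b c : ℕ, ConstacyclicU3.HasExponents I a b c) ∧
        ∀ a b c : ℕ, ConstacyclicU3.HasExponents I a b c →
          -- Type I
          (a = q → b = q →
            c < q ∧ I = Ideal.span {u ^ 2 * ι (f j) ^ c} ∧
            Nat.card I = p ^ (m * d * (q - c)) ∧
            I.annihilator = Ideal.span {ι (f j) ^ (q - c), u}) ∧
          -- Type II
          (a = q → b < q →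
            (∃ (t : ℕ) (G : F[X]), ConstacyclicU3.IsTypeII I b c t G) ∧
            Nat.card I = p ^ (m * d * (2 * q - b - c)) ∧
            ∀ (t : ℕ) (G : F[X]), ConstacyclicU3.IsTypeII I b c t G →
              I.annihilator = Ideal.span
                {ι (f j) ^ (q - c) - u * ι (f j) ^ (q - c + t - b) * ι G,
                  u * ι (f j) ^ (q - b), u ^ 2}) ∧
          -- Type III
          (a < q →
            (∃ (t₁ t₂ θ : ℕ) (D₁ D₂ V : F[X]),
              ConstacyclicU3.IsTypeIII I a b c t₁ t₂ θ D₁ D₂ V) ∧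
            Nat.card I = p ^ (m * d * (3 * q - a - b - c)) ∧
            ∀ (t₁ t₂ θ : ℕ) (D₁ D₂ V : F[X]),
              ConstacyclicU3.IsTypeIII I a b c t₁ t₂ θ D₁ D₂ V →
              ConstacyclicU3.defect (f j) (h j) q a b t₁ t₂ θ D₁ D₂ V
                  ∈ Ideal.span {u ^ 2 * ι (f j) ^ c} ∧
              (∃ B ∈ degreeLT F (d * q),
                ConstacyclicU3.defect (f j) (h j) q a b t₁ t₂ θ D₁ D₂ V
                  = u ^ 2 * ι (f j) ^ c * ι B) ∧
              ∀ B : F[X],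
                ConstacyclicU3.defect (f j) (h j) q a b t₁ t₂ θ D₁ D₂ V
                  = u ^ 2 * ι (f j) ^ c * ι B →
                I.annihilator = Ideal.span
                  {ι (f j) ^ (q - c) - u * ι (f j) ^ (q - c + θ - b) * ι V + u ^ 2 * ι B,
                    u * ι (f j) ^ (q - b) - u ^ 2 * ι (f j) ^ (q - a + t₁ - b) * ι D₁,
                    u ^ 2 * ι (f j) ^ (q - a)}) := by
  classical
  have := Fact.mk hp
  have hchar : CharP F p := charP_of_card_eq_prime_pow hF
  have hpn : ¬ p ∣ n := fun hd => hp.not_dvd_one (hnp ▸ Nat.dvd_gcd hd dvd_rfl)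
  have hα₀0 : α₀ ≠ 0 := by
    rintro rfl
    exact hα (by rw [← hα₀, zero_pow (pow_ne_zero s hp.ne_zero)])
  have hsep : (∏ j, f j).Separable := hprod ▸ separable_X_pow_sub_C' p n α₀ hpn hα₀0
  have : Nonempty (Fin r) := by
    by_contra hr
    rw [not_nonempty_iff] at hr
    rw [Finset.univ_eq_empty, Finset.prod_empty] at hprod
    have := congrArg natDegree hprod
    rw [natDegree_X_pow_sub_C, natDegree_one] at this
    exact hn.ne' this
  have hpow : (X : F[X]) ^ (n * p ^ s) - C α = ∏ j, f j ^ p ^ s := by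
    -- Frobenius: `x^(n p^s) - α = (x^n - α₀)^(p^s)`.
    rw [Finset.prod_pow, ← hprod, sub_pow_char_pow, ← pow_mul, ← C_pow, hα₀]
  have hcard : Nat.card F = p ^ m := by rw [Nat.card_eq_fintype_card, hF]
  refine ⟨?_, fun h hh j => ?_⟩
  · obtain ⟨h, hh⟩ := ConstacyclicU3.exists_factorization f (p ^ s) hsep γ
    exact ⟨h, (ConstacyclicU3.factorization_iff f h _ _ α γ hpow).2 hh⟩
  rw [ConstacyclicU3.factorization_iff f h _ _ α γ hpow] at hh
  have hf := hirr j
  have hm := hmonic j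
  have hfh := ConstacyclicU3.not_dvd_of_factorization f h (pow_ne_zero s hp.ne_zero) hγ hh hf
  intro q d u ι
  have hK : ConstacyclicU3.IsPresentation (f j) (h j) q ι u :=
    ConstacyclicU3.isPresentation (f j) (h j) q
  refine ⟨hK.span_pow_eq hf hfh, fun I hI0 hI1 => ⟨?_, fun a b c hI => ?_⟩⟩
  · obtain ⟨a, b, c, hI⟩ := hK.exists_torsionExponents hf I
    exact ⟨a, b, c, (ConstacyclicU3.hasExponents_iff hm I a b c).2 hI⟩
  rw [ConstacyclicU3.hasExponents_iff hm] at hI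
  have hN : Nat.card I = p ^ (m * d * (3 * q - a - b - c)) := by
    rw [hK.natCard_eq hI hm, hcard, ← pow_mul, mul_assoc]
  refine ⟨fun ha hb => ?_, fun ha hb => ?_, fun ha => ?_⟩
  · have hspan := hK.eq_span_singleton hI hm ha hb
    have hc : c ≤ q := hI.c_le_b.trans hb.le
    refine ⟨lt_of_le_of_ne hc ?_, hspan, ?_, ?_⟩
    -- If `c = q`, the generator `u² f^q` is zero, contradicting `I ≠ 0`.
    · rintro rfl
      refine hI0 ?_
      rw [hspan, Ideal.span_singleton_eq_bot, ← map_pow, hK.u_sq_mul_eq_zero_iff hf.ne_zero]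
    · rw [hN]
      congr 2
      omega
    · conv_lhs => rw [hspan]
      exact hK.annihilator_span_singleton hf.ne_zero hc
  · refine ⟨ConstacyclicU3.exists_isTypeII hI hf hm ha, ?_, fun t G hG =>
      hG.annihilator_eq hI hf.ne_zero⟩
    rw [hN]
    congr 2
    omega
  · exact ⟨ConstacyclicU3.exists_isTypeIII hI hf hm, hN, fun t₁ t₂ θ D₁ D₂ V hD =>
      ⟨by
        obtain ⟨B, -, hB⟩ := hD.exists_defect_eq hI hm
        rw [hB]
        exact Ideal.mul_mem_right _ _ (Ideal.mem_span_singleton_self _),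
      hD.exists_defect_eq hI hm, fun B hB => hD.annihilator_eq hI hf.ne_zero hB⟩⟩
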